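/- Let $X$ be a connected smooth manifold with finite-dimensional cohomology $H^*(X)=H^*(X;\mathbb{C})$, regarded as a complex algebra under the cup product and carrying the topology of a finite-dimensional vector space (so that $o(1)$ refers to any norm). For $\alpha\in H^*(X)$ write $\alpha=\alpha_0+\alpha_+$ with $\alpha_0\in H^0(X)=\mathbb{C}$ and $\alpha_+$ of positive degree (hence nilpotent). For $f$ holomorphic near $\alpha_0$ put $f(\alpha)=\sum_{k\ge 0}\frac{f^{(k)}(\alpha_0)}{k!}\alpha_+^k$; this defines $\Gamma(\alpha)$ for $\alpha_0\notin\{0,-1,-2,\dots\}$, and $e^{\alpha}$. Put $x^\alpha=e^{\alpha\log x}$ for $x>0$ and $t^{\alpha}=e^{(\log s+\mathtt{i}\phi)\alpha}$ for $t=se^{\mathtt{i}\phi}$ with $s>0$, $\phi\in\mathbb{R}$; here $t$ is a point of the universal covering of $\mathbb{C}^\times$ with $|t|=s$, and $t\to e^{\mathtt{i}\phi}\cdot\infty$ means $s\to+\infty$ with $\phi$ fixed. Let $r\in\mathbb{N}_{>0}$, let $\beta,\alpha_{rm}\in H^*(X)$ $(m\in\mathbb{N})$, and consider the series $$\alpha(t)=\sum_{m=0}^\infty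 t^{rm+\beta}\,\alpha_{rm}.$$ (Functions of $\beta$ are written to the left of the other classes; if $\beta$ has even degree they are central and the order does not matter.) Let $T\in\mathbb{R}_{>0}$, $\theta\in\mathbb{R}$, $A\in H^*(X)$, and assume that $\alpha(t)$ is $(T,\theta,A)$-scaled asymptotically Mittag-Leffler, that is, as $m\to\infty$, $$\alpha_{rm}=\frac{T^{rm+\beta}e^{\mathtt{i}\theta(rm+\beta)}}{\Gamma(1+rm+\beta)}\cdot\bigl(A+o(1)\bigr).$$ Let $\phi\in\mathbb{R}$. Then the series converges at every $t=se^{\mathtt{i}\phi}$, $s>0$, and as $t\to e^{\mathtt{i}\phi}\cdot\infty$, $$\alpha(t)=\begin{cases}\frac1r\,e^{\mathtt{i}(\theta+\phi)\beta}\,e^{T|t|}\cdot\bigl(A+o(1)\bigr)&\text{when }\theta+\phi\in\frac{2\pi}{r}\mathbb{Z},\\ e^{T|t|}\cdot o(1)&\text{otherwise.}\end{cases}$$ Moreover, if for some $L\in\mathbb{N}$ and $A_0(=A),\dots,A_L\in H^*(X)$, as $m\to\infty$, $$\alpha_{rm}=\frac{T^{rm+\beta}e^{\mathtt{i}\theta(rm+\beta)}}{\Gamma(1+rm+\beta)}\cdot\Bigl(\sum_{\ell=0}^L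 A_\ell m^{-\ell}+o(m^{-L})\Bigr),$$ then, as $t\to e^{\mathtt{i}\phi}\cdot\infty$, $$\alpha(t)=\begin{cases}e^{T|t|}\cdot\Bigl(\sum_{\ell=0}^L\frac1r\,e^{\mathtt{i}(\theta+\phi)\beta}\,B_\ell\,(T|t|)^{-\ell}+o(|t|^{-L})\Bigr)&\text{when }\theta+\phi\in\frac{2\pi}{r}\mathbb{Z},\\ e^{T|t|}\cdot o(|t|^{-L})&\text{otherwise,}\end{cases}$$ for some $B_0(=A),\dots,B_L\in H^*(X)$. -/

import Mathlib

open Filter Topology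
open scoped Manifold ContDiff

noncomputable section

/-! ## The singular cohomology ring with complex coefficients -/

namespace SingularCohomology

variable {X : Type*} [TopologicalSpace X]

/-- Singular `n`-simplices of `X`. -/
abbrev Simplex (X : Type*) [TopologicalSpace X] (n : ℕ) : Type _ :=
  C(stdSimplex ℝ (Fin (n + 1)), X)

/-- The singular `p`-simplex spanned by the vertices `φ 0, …, φ p` of the singular `n`-simplex `σ`
(only used when these vertex numbers are at most `n`). -/
def face {n : ℕ} (σ : Simplex X n) (p : ℕ) (φ : ℕ → ℕ) : Simplex X p :=
  σ.comp ⟨stdSimplex.map fun i : Fin (p + 1) ↦ (⟨min (φ i) n, by omega⟩ : Fin (n + 1)),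
    stdSimplex.continuous_map _⟩

/-- The order embedding of `ℕ` that skips the value `i`. -/
def skip (i j : ℕ) : ℕ := if j < i then j else j + 1

theorem face_face {n : ℕ} (σ : Simplex X n) {p q : ℕ} {φ ψ : ℕ → ℕ} (h : ∀ i ≤ q, ψ i ≤ p) :
    face (face σ p φ) q ψ = face σ q (fun i ↦ φ (ψ i)) := by
  ext x
  simp only [face, ContinuousMap.comp_apply, ContinuousMap.coe_mk, stdSimplex.map_comp_apply]
  congr 2
  funext i
  have := h i (by omega)
  simp [Function.comp, this]

theorem face_congr {n : ℕ} (σ : Simplex X n) {p : ℕ} {φ ψ : ℕ → ℕ} (h : ∀ i ≤ p, φ i = ψ i) :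
    face σ p φ = face σ p ψ := by
  unfold face
  congr 3
  funext i
  simp [h i (by omega)]

theorem face_self {n : ℕ} (σ : Simplex X n) {φ : ℕ → ℕ} (h : ∀ i ≤ n, φ i = i) :
    face σ n φ = σ := by
  have : (fun i : Fin (n + 1) ↦ (⟨min (φ i) n, by omega⟩ : Fin (n + 1))) = id := by
    funext i
    ext
    have := h i (by omega)
    simp only [this, id]
    omega
  ext x
  simp only [face, this, ContinuousMap.comp_apply, ContinuousMap.coe_mk, stdSimplex.map_id_apply]

/-- Singular cochains of all degrees: families `(f n)` of complex valued functions on the singular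
`n`-simplices of which only finitely many are nonzero. -/
def cochainSubmodule (X : Type*) [TopologicalSpace X] : Submodule ℂ (∀ n, Simplex X n → ℂ) where
  carrier := {f | ∃ N, ∀ n, N ≤ n → f n = 0}
  zero_mem' := ⟨0, fun _ _ ↦ rfl⟩
  add_mem' := by
    rintro f g ⟨N, hN⟩ ⟨M, hM⟩
    refine ⟨max N M, fun n hn ↦ ?_⟩
    simp [hN n (le_trans (le_max_left _ _) hn), hM n (le_trans (le_max_right _ _) hn)]
  smul_mem' := by
    rintro c f ⟨N, hN⟩
    exact ⟨N, fun n hn ↦ by simp [hN n hn]⟩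

/-- The complex vector space of singular cochains `⨁ₙ Cⁿ(X; ℂ)`. -/
def Cochain (X : Type*) [TopologicalSpace X] : Type _ := cochainSubmodule X

instance : AddCommGroup (Cochain X) := inferInstanceAs (AddCommGroup (cochainSubmodule X))

instance : Module ℂ (Cochain X) := inferInstanceAs (Module ℂ (cochainSubmodule X))

namespace Cochain

/-- The degree `n` component of a cochain. -/
def app (f : Cochain X) (n : ℕ) (σ : Simplex X n) : ℂ := f.1 n σ

theorem ext {f g : Cochain X} (h : ∀ n σ, f.app n σ = g.app n σ) : f = g :=
  Subtype.ext (funext fun n ↦ funext fun σ ↦ h n σ)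

theorem app_bound (f : Cochain X) : ∃ N, ∀ n, N ≤ n → ∀ σ, f.app n σ = 0 := by
  obtain ⟨N, hN⟩ := f.2
  exact ⟨N, fun n hn σ ↦ congrFun (hN n hn) σ⟩

/-- A cochain from its components. -/
def mk (f : ∀ n, Simplex X n → ℂ) (h : ∃ N, ∀ n, N ≤ n → ∀ σ, f n σ = 0) : Cochain X :=
  ⟨f, by
    obtain ⟨N, hN⟩ := h
    exact ⟨N, fun n hn ↦ funext fun σ ↦ hN n hn σ⟩⟩

@[simp] theorem app_mk (f : ∀ n, Simplex X n → ℂ) (h) (n : ℕ) (σ : Simplex X n) :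
    (mk f h).app n σ = f n σ := rfl
@[simp] theorem app_zero (n : ℕ) (σ : Simplex X n) : (0 : Cochain X).app n σ = 0 := rfl
@[simp] theorem app_add (f g : Cochain X) (n : ℕ) (σ : Simplex X n) :
    (f + g).app n σ = f.app n σ + g.app n σ := rfl
@[simp] theorem app_smul (c : ℂ) (f : Cochain X) (n : ℕ) (σ : Simplex X n) :
    (c • f).app n σ = c * f.app n σ := rfl

theorem app_face_congr (f : Cochain X) {n : ℕ} (σ : Simplex X n) {p q : ℕ} (hpq : p = q)
    {φ ψ : ℕ → ℕ} (h : ∀ i ≤ p, φ i = ψ i) :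
    f.app p (face σ p φ) = f.app q (face σ q ψ) := by
  subst hpq
  rw [face_congr σ h]

/-- The cup product: `(f ∪ g)(σ) = ∑ₖ f(σ|[0,…,k]) g(σ|[k,…,n])` for an `n`-simplex `σ`. -/
instance : Mul (Cochain X) where
  mul f g := mk
    (fun n σ ↦ ∑ k ∈ Finset.range (n + 1),
      f.app k (face σ k fun i ↦ i) * g.app (n - k) (face σ (n - k) fun i ↦ i + k)) (by
    obtain ⟨N, hN⟩ := f.app_bound
    obtain ⟨M, hM⟩ := g.app_bound
    refine ⟨N + M, fun n hn σ ↦ Finset.sum_eq_zero fun k _ ↦ ?_⟩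
    rcases le_or_gt N k with hk | hk
    · rw [hN k hk, zero_mul]
    · rw [hM (n - k) (by omega), mul_zero])

/-- The unit: the `0`-cochain with constant value `1`. -/
instance : One (Cochain X) where
  one := mk (fun n _ ↦ if n = 0 then 1 else 0) ⟨1, fun n hn _ ↦ if_neg (by omega)⟩

theorem app_mul (f g : Cochain X) (n : ℕ) (σ : Simplex X n) :
    (f * g).app n σ = ∑ k ∈ Finset.range (n + 1),
      f.app k (face σ k fun i ↦ i) * g.app (n - k) (face σ (n - k) fun i ↦ i + k) := rfl

theorem app_one (n : ℕ) (σ : Simplex X n) :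
    (1 : Cochain X).app n σ = if n = 0 then 1 else 0 := rfl

theorem app_mul_face (f g : Cochain X) {n : ℕ} (σ : Simplex X n) (p : ℕ) (φ : ℕ → ℕ) :
    (f * g).app p (face σ p φ) = ∑ k ∈ Finset.range (p + 1),
      f.app k (face σ k φ) * g.app (p - k) (face σ (p - k) fun i ↦ φ (i + k)) := by
  rw [app_mul]
  refine Finset.sum_congr rfl fun k hk ↦ ?_
  have := Finset.mem_range.1 hk
  rw [face_face σ (fun i hi ↦ by omega), face_face σ (fun i hi ↦ by omega)]

protected theorem mul_assoc (f g h : Cochain X) : f * g * h = f * (g * h) := by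
  refine ext fun n σ ↦ ?_
  rw [app_mul, app_mul]
  simp only [app_mul_face, Finset.sum_mul, Finset.mul_sum]
  rw [Finset.sum_sigma', Finset.sum_sigma']
  refine Finset.sum_nbij' (fun x ↦ ⟨x.2, x.1 - x.2⟩) (fun x ↦ ⟨x.1 + x.2, x.1⟩) ?_ ?_ ?_ ?_ ?_
  · rintro ⟨k, j⟩ hx
    simp only [Finset.mem_sigma, Finset.mem_range] at hx ⊢
    omega
  · rintro ⟨k, j⟩ hx
    simp only [Finset.mem_sigma, Finset.mem_range] at hx ⊢
    omega
  · rintro ⟨k, j⟩ hx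
    simp only [Finset.mem_sigma, Finset.mem_range] at hx
    simp only [Sigma.mk.injEq, heq_eq_eq, and_true]
    omega
  · rintro ⟨k, j⟩ hx
    simp
  · rintro ⟨k, j⟩ hx
    simp only [Finset.mem_sigma, Finset.mem_range] at hx
    simp only
    rw [mul_assoc]
    congr 2
    refine app_face_congr h σ (by omega) fun i _ ↦ by omega

protected theorem one_mul (f : Cochain X) : 1 * f = f := by
  refine ext fun n σ ↦ ?_
  rw [app_mul, Finset.sum_eq_single_of_mem 0 (by simp) (fun k _ hk ↦ by simp [app_one, hk])]
  simp only [app_one, if_true, one_mul, Nat.sub_zero, add_zero]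
  rw [face_self σ (fun _ _ ↦ rfl)]

protected theorem mul_one (f : Cochain X) : f * 1 = f := by
  refine ext fun n σ ↦ ?_
  rw [app_mul, Finset.sum_eq_single_of_mem n (by simp)]
  · rw [face_self σ (fun _ _ ↦ rfl)]
    simp [app_one]
  · intro k hk hkn
    have := Finset.mem_range.1 hk
    rw [app_one, if_neg (by omega), mul_zero]

instance : Ring (Cochain X) :=
  { (inferInstance : AddCommGroup (Cochain X)) with
    mul := (· * ·)
    one := 1
    mul_assoc := Cochain.mul_assoc
    one_mul := Cochain.one_mul
    mul_one := Cochain.mul_one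
    left_distrib := fun f g h ↦ ext fun n σ ↦ by
      simp only [app_mul, app_add, mul_add, Finset.sum_add_distrib]
    right_distrib := fun f g h ↦ ext fun n σ ↦ by
      simp only [app_mul, app_add, add_mul, Finset.sum_add_distrib]
    zero_mul := fun f ↦ ext fun n σ ↦ by simp [app_mul]
    mul_zero := fun f ↦ ext fun n σ ↦ by simp [app_mul] }

instance : Algebra ℂ (Cochain X) :=
  Algebra.ofModule
    (fun c f g ↦ ext fun n σ ↦ by
      simp only [app_mul, app_smul, Finset.mul_sum, mul_assoc])
    (fun c f g ↦ ext fun n σ ↦ by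
      simp only [app_mul, app_smul, Finset.mul_sum, mul_left_comm])

/-- The components of the coboundary: `(d f)(σ) = ∑ᵢ (-1)ⁱ f(∂ᵢ σ)`. -/
def coboundaryFun (f : Cochain X) : ∀ n, Simplex X n → ℂ
  | 0, _ => 0
  | n + 1, σ => ∑ i ∈ Finset.range (n + 2), (-1) ^ i * f.app n (face σ n (skip i))

/-- The coboundary operator `d`. -/
def coboundary : Cochain X →ₗ[ℂ] Cochain X where
  toFun f := mk (coboundaryFun f) (by
    obtain ⟨N, hN⟩ := f.app_bound
    refine ⟨N + 1, fun n hn σ ↦ ?_⟩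
    obtain ⟨m, rfl⟩ : ∃ m, n = m + 1 := ⟨n - 1, by omega⟩
    exact Finset.sum_eq_zero fun i _ ↦ by rw [hN m (by omega), mul_zero])
  map_add' f g := ext fun n σ ↦ by
    cases n with
    | zero => simp [coboundaryFun]
    | succ n => simp [coboundaryFun, mul_add, Finset.sum_add_distrib]
  map_smul' c f := ext fun n σ ↦ by
    cases n with
    | zero => simp [coboundaryFun]
    | succ n => simp [coboundaryFun, Finset.mul_sum, mul_left_comm]

@[simp] theorem app_coboundary_zero (f : Cochain X) (σ : Simplex X 0) :
    (coboundary f).app 0 σ = 0 := rfl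

theorem app_coboundary_succ (f : Cochain X) (n : ℕ) (σ : Simplex X (n + 1)) :
    (coboundary f).app (n + 1) σ =
      ∑ i ∈ Finset.range (n + 2), (-1) ^ i * f.app n (face σ n (skip i)) := rfl

/-- The grading involution, `(-1)ⁿ` in degree `n`. -/
def signed (f : Cochain X) : Cochain X :=
  mk (fun n σ ↦ (-1) ^ n * f.app n σ) (by
    obtain ⟨N, hN⟩ := f.app_bound
    exact ⟨N, fun n hn σ ↦ by rw [hN n hn, mul_zero]⟩)

@[simp] theorem app_signed (f : Cochain X) (n : ℕ) (σ : Simplex X n) :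
    f.signed.app n σ = (-1) ^ n * f.app n σ := rfl

theorem signed_signed (f : Cochain X) : f.signed.signed = f :=
  ext fun n σ ↦ by
    rw [app_signed, app_signed, ← mul_assoc, ← mul_pow]
    simp

theorem coboundary_signed (f : Cochain X) : coboundary f.signed = -(coboundary f).signed := by
  rw [← add_eq_zero_iff_eq_neg]
  refine ext fun n σ ↦ ?_
  cases n with
  | zero => simp
  | succ n =>
    simp only [app_add, app_signed, app_coboundary_succ, Finset.mul_sum, app_zero,
      ← Finset.sum_add_distrib]
    exact Finset.sum_eq_zero fun i _ ↦ by ring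

/-- The Leibniz rule. -/
theorem coboundary_mul (f g : Cochain X) :
    coboundary (f * g) = coboundary f * g + f.signed * coboundary g := by
  refine ext fun n σ ↦ ?_
  cases n with
  | zero => simp [app_mul]
  | succ n =>
    rw [app_add, app_mul (coboundary f), app_mul f.signed, Finset.sum_range_succ' _ (n + 1),
      Finset.sum_range_succ _ (n + 1), app_coboundary_succ (f * g)]
    simp only [app_mul_face, Finset.mul_sum]
    have h0 : (coboundary f).app 0 (face σ 0 fun i ↦ i) = 0 := rfl
    have h1 : (coboundary g).app (n + 1 - (n + 1)) (face σ (n + 1 - (n + 1)) fun i ↦ i + (n + 1))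
        = 0 := by
      generalize hz : n + 1 - (n + 1) = z
      obtain rfl : z = 0 := by omega
      rfl
    rw [h0, h1, zero_mul, mul_zero, add_zero, add_zero, ← Finset.sum_add_distrib,
      Finset.sum_comm]
    refine Finset.sum_congr rfl fun k hk ↦ ?_
    have hkn : k ≤ n := Nat.lt_succ_iff.1 (Finset.mem_range.1 hk)
    have hdg : (coboundary g).app (n + 1 - k) (face σ (n + 1 - k) fun i ↦ i + k) =
        ∑ i ∈ Finset.range (n - k + 2),
          (-1) ^ i * g.app (n - k) (face σ (n - k) fun j ↦ skip i j + k) := by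
      rw [app_face_congr (coboundary g) σ (show n + 1 - k = n - k + 1 by omega)
        (fun _ _ ↦ rfl), app_coboundary_succ]
      refine Finset.sum_congr rfl fun i hi ↦ ?_
      rw [face_face σ (fun j hj ↦ by unfold skip; split <;> omega)]
    rw [hdg, app_coboundary_succ, show n + 2 = (k + 1) + (n - k + 1) by omega,
      Finset.sum_range_add, Finset.sum_range_succ _ (k + 1), Finset.sum_range_succ' _ (n - k + 1)]
    have hG : ∀ i ≤ k, g.app (n - k) (face σ (n - k) fun j ↦ skip i (j + k)) =
        g.app (n + 1 - (k + 1)) (face σ (n + 1 - (k + 1)) fun j ↦ j + (k + 1)) := fun i hi ↦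
      app_face_congr g σ (by omega) fun j hj ↦ by unfold skip; split <;> omega
    have hG0 : g.app (n - k) (face σ (n - k) fun j ↦ skip 0 j + k) =
        g.app (n + 1 - (k + 1)) (face σ (n + 1 - (k + 1)) fun j ↦ j + (k + 1)) :=
      app_face_congr g σ (by omega) fun j hj ↦ by unfold skip; split <;> omega
    have hF : ∀ i, k < i → f.app k (face σ k (skip i)) = f.app k (face σ k fun j ↦ j) :=
      fun i hi ↦ app_face_congr f σ rfl fun j hj ↦ by unfold skip; split <;> omega
    have hff : ∀ i, f.app k (face (face σ (k + 1) fun j ↦ j) k (skip i)) =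
        f.app k (face σ k (skip i)) := fun i ↦ by
      rw [face_face σ (fun j hj ↦ by unfold skip; split <;> omega)]
    simp only [hff]
    rw [hF (k + 1) (by omega), hG0, app_signed]
    have e1 : ∀ i ∈ Finset.range (k + 1),
        (-1) ^ i * (f.app k (face σ k (skip i)) *
          g.app (n - k) (face σ (n - k) fun j ↦ skip i (j + k))) =
        (-1) ^ i * f.app k (face σ k (skip i)) *
          g.app (n + 1 - (k + 1)) (face σ (n + 1 - (k + 1)) fun j ↦ j + (k + 1)) :=
      fun i hi ↦ by rw [hG i (Nat.lt_succ_iff.1 (Finset.mem_range.1 hi)), mul_assoc]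
    have e2 : ∀ i ∈ Finset.range (n - k + 1),
        (-1) ^ (k + 1 + i) * (f.app k (face σ k (skip (k + 1 + i))) *
          g.app (n - k) (face σ (n - k) fun j ↦ skip (k + 1 + i) (j + k))) =
        (-1) ^ k * f.app k (face σ k fun j ↦ j) * ((-1) ^ (i + 1) *
          g.app (n - k) (face σ (n - k) fun j ↦ skip (i + 1) j + k)) := fun i hi ↦ by
      rw [hF _ (by omega), app_face_congr g σ rfl (φ := fun j ↦ skip (k + 1 + i) (j + k))
        (ψ := fun j ↦ skip (i + 1) j + k) (fun j hj ↦ by unfold skip; split <;> split <;> omega)]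
      ring
    rw [Finset.sum_congr rfl e1, Finset.sum_congr rfl e2, ← Finset.sum_mul, ← Finset.mul_sum]
    ring

theorem coboundary_coboundary (f : Cochain X) : coboundary (coboundary f) = 0 := by
  refine ext fun n σ ↦ ?_
  rcases n with _ | _ | n
  · rfl
  · rw [app_coboundary_succ]
    exact Finset.sum_eq_zero fun i _ ↦ by rw [app_coboundary_zero, mul_zero]
  · simp only [app_coboundary_succ, Finset.mul_sum, app_zero]
    rw [Finset.sum_sigma']
    refine Finset.sum_involution
      (fun x _ ↦ if x.1 ≤ x.2 then ⟨x.2 + 1, x.1⟩ else ⟨x.2, x.1 - 1⟩) ?_ ?_ ?_ ?_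
    · rintro ⟨i, j⟩ hx
      simp only [Finset.mem_sigma, Finset.mem_range] at hx
      rw [face_face σ (fun l hl ↦ by unfold skip; split <;> omega)]
      dsimp only
      split
      · dsimp only
        rw [face_face σ (fun l hl ↦ by unfold skip; split <;> omega),
          face_congr σ (φ := fun l ↦ skip i (skip j l)) (ψ := fun l ↦ skip (j + 1) (skip i l))
            (fun l hl ↦ by unfold skip; split_ifs <;> omega)]
        ring
      · obtain ⟨i, rfl⟩ : ∃ m, i = m + 1 := ⟨i - 1, by omega⟩
        dsimp only
        rw [face_face σ (fun l hl ↦ by unfold skip; split <;> omega),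
          face_congr σ (φ := fun l ↦ skip (i + 1) (skip j l))
            (ψ := fun l ↦ skip j (skip (i + 1 - 1) l))
            (fun l hl ↦ by unfold skip; split_ifs <;> omega)]
        simp only [Nat.add_sub_cancel]
        ring
    · rintro ⟨i, j⟩ hx _ h
      dsimp only at h
      split_ifs at h <;> simp only [Sigma.mk.injEq, heq_eq_eq] at h <;> omega
    · rintro ⟨i, j⟩ hx
      simp only [Finset.mem_sigma, Finset.mem_range] at hx
      dsimp only
      split_ifs <;> simp only [Finset.mem_sigma, Finset.mem_range] <;> omega
    · rintro ⟨i, j⟩ hx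
      dsimp only
      by_cases h : i ≤ j
      · simp [h]
      · have h' : j ≤ i - 1 := by omega
        simp only [h, h', if_true, if_false, Sigma.mk.injEq, heq_eq_eq, and_true]
        omega

theorem coboundary_one : coboundary (1 : Cochain X) = 0 := by
  have h := coboundary_mul (1 : Cochain X) 1
  have hs : (1 : Cochain X).signed = 1 := ext fun n σ ↦ by
    cases n <;> simp [app_one]
  rw [hs, one_mul, mul_one, one_mul] at h
  simpa using h

end Cochain

/-- The algebra of cocycles, the kernel of `d`. -/
def cocycles (X : Type*) [TopologicalSpace X] : Subalgebra ℂ (Cochain X) where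
  carrier := {f | Cochain.coboundary f = 0}
  mul_mem' := by
    intro f g hf hg
    simp only [Set.mem_ofPred_eq] at hf hg ⊢
    rw [Cochain.coboundary_mul, hf, hg, zero_mul, mul_zero, add_zero]
  add_mem' := by
    intro f g hf hg
    simp only [Set.mem_ofPred_eq] at hf hg ⊢
    rw [map_add, hf, hg, add_zero]
  algebraMap_mem' := by
    intro c
    simp only [Set.mem_ofPred_eq]
    rw [Algebra.algebraMap_eq_smul_one, map_smul, Cochain.coboundary_one, smul_zero]

/-- The two-sided ideal of coboundaries, the image of `d`, in the algebra of cocycles. -/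
def coboundaries (X : Type*) [TopologicalSpace X] : Ideal (cocycles X) where
  carrier := {z | ∃ g, Cochain.coboundary g = (z : Cochain X)}
  zero_mem' := ⟨0, by simp⟩
  add_mem' := by
    rintro z w ⟨g, hg⟩ ⟨h, hh⟩
    exact ⟨g + h, by rw [map_add, hg, hh]; rfl⟩
  smul_mem' := by
    rintro z w ⟨g, hg⟩
    refine ⟨(z : Cochain X).signed * g, ?_⟩
    have hz : Cochain.coboundary (z : Cochain X) = 0 := z.2
    have h0 : (0 : Cochain X).signed = 0 := Cochain.ext fun n σ ↦ by simp
    rw [Cochain.coboundary_mul, Cochain.coboundary_signed, hz, h0, neg_zero, zero_mul, zero_add,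
      Cochain.signed_signed, hg]
    rfl

instance : (coboundaries X).IsTwoSided where
  mul_mem_of_left := by
    rintro w z ⟨g, hg⟩
    refine ⟨g * (z : Cochain X), ?_⟩
    have hz : Cochain.coboundary (z : Cochain X) = 0 := z.2
    rw [Cochain.coboundary_mul, hz, mul_zero, add_zero, hg]
    rfl

end SingularCohomology

open SingularCohomology

/-- The cohomology ring `H^*(X) = H^*(X; ℂ) = ⨁ₙ Hⁿ(X; ℂ)` of a topological space, a complex
algebra under the cup product. -/
def Cohomology (X : Type*) [TopologicalSpace X] : Type _ := cocycles X ⧸ coboundaries X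

namespace Cohomology

variable {X : Type*} [TopologicalSpace X]

instance : Ring (Cohomology X) := inferInstanceAs (Ring (cocycles X ⧸ coboundaries X))

instance : Algebra ℂ (Cohomology X) := inferInstanceAs (Algebra ℂ (cocycles X ⧸ coboundaries X))

/-- The vector space topology of `H^*(X)`. If `H^*(X)` is finite-dimensional, this is the topology
given by any norm. -/
instance : TopologicalSpace (Cohomology X) := moduleTopology ℂ (Cohomology X)

instance : IsModuleTopology ℂ (Cohomology X) := ⟨rfl⟩

/-- The restriction `H^*(X) → H^*(pt) = ℂ` to a point `x` of `X`. -/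
def restrict (x : X) : Cohomology X →ₐ[ℂ] ℂ :=
  Ideal.Quotient.liftₐ (coboundaries X)
    { toFun := fun f ↦ (f : Cochain X).app 0 (ContinuousMap.const _ x)
      map_one' := by
        change (1 : Cochain X).app 0 _ = 1
        simp [Cochain.app_one]
      map_mul' := fun f g ↦ by
        change ((f : Cochain X) * (g : Cochain X)).app 0 _ = _
        rw [Cochain.app_mul, Finset.sum_range_one]
        rfl
      map_zero' := rfl
      map_add' := fun f g ↦ rfl
      commutes' := fun c ↦ by
        change (algebraMap ℂ (Cochain X) c).app 0 _ = c
        rw [Algebra.algebraMap_eq_smul_one]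
        simp [Cochain.app_one] }
    (by
      rintro z ⟨g, hg⟩
      change (z : Cochain X).app 0 _ = 0
      rw [← hg]
      rfl)

/-- The `H^0`-component `α₀` of `α`, as a complex number. For connected `X`, when `H^0(X) = ℂ`, it
is the restriction of `α` to any point of `X`. -/
def degZero [Nonempty X] (α : Cohomology X) : ℂ := restrict (Classical.arbitrary X) α

/-- The component `α - α₀` of `α` in positive degrees. It is nilpotent if `X` is connected (and
locally path-connected) and `H^*(X)` is finite-dimensional. -/
def degPos [Nonempty X] (α : Cohomology X) : Cohomology X :=
  α - algebraMap ℂ (Cohomology X) (degZero α)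

/-- The value of a function `f`, holomorphic near `α₀`, at a cohomology class
`α`: `f(α) = ∑ₖ f⁽ᵏ⁾(α₀) / k! · (α - α₀)ᵏ`, a finite sum because `α - α₀` is nilpotent. -/
def taylor [Nonempty X] (f : ℂ → ℂ) (α : Cohomology X) : Cohomology X :=
  ∑ k ∈ Finset.range (nilpotencyClass (degPos α)),
    (iteratedDeriv k f (degZero α) / (k.factorial : ℂ)) • degPos α ^ k

/-- The exponential `e^α`. -/
def exp [Nonempty X] (α : Cohomology X) : Cohomology X := taylor Complex.exp α

/-- The Gamma function `Γ(α)` (meaningful if `α₀` is not one of `0, -1, -2, …`). -/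
def Gamma [Nonempty X] (α : Cohomology X) : Cohomology X := taylor Complex.Gamma α

/-- `x^α = e^{α log x}` for a positive real number `x`. -/
def rpow [Nonempty X] (x : ℝ) (α : Cohomology X) : Cohomology X :=
  exp ((Real.log x : ℂ) • α)

/-- `e^{iθα}`, for a real number `θ`. -/
def cis [Nonempty X] (θ : ℝ) (α : Cohomology X) : Cohomology X :=
  exp ((Complex.I * θ) • α)

end Cohomology

open Cohomology

variable {X : Type*} [TopologicalSpace X] [Nonempty X]

/-- The coefficient `T^{rm+β} e^{iθ(rm+β)} / Γ(1+rm+β)` of a Mittag-Leffler type series. -/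
def mittagLefflerCoeff (r : ℕ) (β : Cohomology X) (T θ : ℝ) (m : ℕ) : Cohomology X :=
  rpow T (((r * m : ℕ) : Cohomology X) + β) * cis θ (((r * m : ℕ) : Cohomology X) + β) *
    Ring.inverse (Gamma (1 + ((r * m : ℕ) : Cohomology X) + β))

/-- The series `∑ₘ α_{rm} t^{rm+β}`, with `a m = α_{rm}`, is `(T, θ, A)`-scaled asymptotically
Mittag-Leffler: `α_{rm} = T^{rm+β} e^{iθ(rm+β)} / Γ(1+rm+β) · (A + o(1))` as `m → ∞`. -/
def IsAsymptoticallyMittagLeffler (r : ℕ) (a : ℕ → Cohomology X) (β : Cohomology X) (T θ : ℝ)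
    (A : Cohomology X) : Prop :=
  ∃ R : ℕ → Cohomology X, Tendsto R atTop (𝓝 0) ∧
    ∀ᶠ m in atTop, a m = mittagLefflerCoeff r β T θ m * (A + R m)

/-- The refined condition
`α_{rm} = T^{rm+β} e^{iθ(rm+β)} / Γ(1+rm+β) · (∑_{ℓ ≤ L} A_ℓ m^{-ℓ} + o(m^{-L}))` as `m → ∞`. -/
def HasMittagLefflerExpansion (r : ℕ) (a : ℕ → Cohomology X) (β : Cohomology X) (T θ : ℝ)
    (L : ℕ) (A : ℕ → Cohomology X) : Prop :=
  ∃ R : ℕ → Cohomology X, Tendsto R atTop (𝓝 0) ∧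
    ∀ᶠ m : ℕ in atTop, a m = mittagLefflerCoeff r β T θ m *
      (∑ l ∈ Finset.range (L + 1), ((m : ℂ) ^ l)⁻¹ • A l + ((m : ℂ) ^ L)⁻¹ • R m)

/-- The term `α_{rm} t^{rm+β}` at the point `t = s e^{iφ}` (with `log t = log s + iφ`) of the
universal covering of the punctured plane. Powers of `t` are always written to the left of the
coefficients; they are central if `β` has even degree. -/
def seriesTerm (r : ℕ) (a : ℕ → Cohomology X) (β : Cohomology X) (φ s : ℝ) (m : ℕ) :
    Cohomology X :=
  exp (((Real.log s : ℂ) + Complex.I * φ) • (((r * m : ℕ) : Cohomology X) + β)) * a m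

/-- The sum `α(t) = ∑ₘ α_{rm} t^{rm+β}` at `t = s e^{iφ}`. -/
def seriesSum (r : ℕ) (a : ℕ → Cohomology X) (β : Cohomology X) (φ s : ℝ) : Cohomology X :=
  ∑' m, seriesTerm r a β φ s m

end

/-!
All functions of `β` take values in the commutative algebra generated by `β`, and
`β = β₀ + b` with `b` nilpotent (`Cohomology.isNilpotent_degPos`): a power of a class of positive
degree is a multiple of its higher powers, by finite-dimensionality, and so has representatives in
arbitrarily high degrees, which forces it to vanish. The value `taylorAt β₀ b f` of a holomorphic
function `f` at `β` is multiplicative in `f` and, by Cauchy's estimates, controlled by the supremum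
of `f` on the disc of radius one about `β₀`. Hence everything reduces to estimates of holomorphic
functions of a complex exponent `z` that are uniform on this disc.

With `x = T s` and `ξ = e^{i(θ+φ)}` the terms of the series are, up to the factor `e^{i(θ+φ)β}`,
`ξ^{rm} x^{rm+β} / Γ(1+rm+β)` times a coefficient `ρₘ = A + o(1)`. Two facts are needed.

* The suprema over the disc of `x^{n+z} / Γ(1+n+z)` have a sum over `n` of size `O(eˣ)`
  (`exists_mlTerm_majorant`). So, by a Toeplitz argument, coefficients `ρₘ = o(1)` contribute
  `o(eˣ)` (`tendsto_exp_neg_smul_mlSum_zero`).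
* For constant `ρ` and `r = 1` the sum is
  `Γ(z)⁻¹ ∫₀ˣ e^{ξ(x-t)} t^{z-1} dt` when `Re z > 1` (`hasSum_mlTerm_integral`). This is `eˣ` for
  `ξ = 1`, and zero for other `ξ` on the unit circle, up to errors exponentially smaller than `eˣ`.
  Averaging over the `r`-th roots of unity gives the sum over the multiples of `r`, which is
  `eˣ / r` if `ξ ^ r = 1` and negligible otherwise
  (`exists_norm_tsum_mlTerm_multiples_sub_le`).

The higher order expansion follows by induction on the order (`exists_expansion_mlSum`): with `A`
the limit of `ρₘ`,
`(ρₘ - A) / Γ(1+rm+β) = (1+rm+β)(ρₘ - A) / Γ(1+rm+(β+1))`, where `(1+rm+β)(ρₘ - A)` has an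
expansion of order one less, and the raised exponent produces the factor `x⁻¹`.
-/

section

open SingularCohomology Cohomology

/-! ### Nilpotency of the classes of positive degree -/

namespace SingularCohomology

variable {X : Type*} [TopologicalSpace X]

/-- The cochain `f` vanishes on all simplices of dimension less than `k`. -/
def VanishesBelow (k : ℕ) (f : Cochain X) : Prop := ∀ n < k, ∀ σ, f.app n σ = 0

theorem VanishesBelow.mul {j k : ℕ} {f g : Cochain X} (hf : VanishesBelow j f)
    (hg : VanishesBelow k g) : VanishesBelow (j + k) (f * g) := by
  intro n hn σ
  rw [Cochain.app_mul]
  refine Finset.sum_eq_zero fun i hi ↦ ?_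
  have := Finset.mem_range.1 hi
  rcases lt_or_ge i j with h | h
  · rw [hf i h, zero_mul]
  · rw [hg _ (by omega), mul_zero]

/-- The truncation of a cochain to the degrees less than `k`. -/
def truncate (k : ℕ) (f : Cochain X) : Cochain X :=
  Cochain.mk (fun n σ ↦ if n < k then f.app n σ else 0) ⟨k, fun n hn σ ↦ if_neg (by omega)⟩

theorem coboundary_truncate (k : ℕ) (f : Cochain X) :
    Cochain.coboundary (truncate k f) = truncate (k + 1) (Cochain.coboundary f) := by
  refine Cochain.ext fun n σ ↦ ?_
  cases n with
  | zero => simp [truncate]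
  | succ n =>
    simp only [truncate, Cochain.app_coboundary_succ, Cochain.app_mk]
    by_cases h : n < k
    · simp [h]
    · simp [h]

/-- The classes in `H^*(X)` represented by cocycles that vanish in degrees less than `k`, that is
`⨁_{n ≥ k} Hⁿ(X)`. -/
def degreeFiltration (X : Type*) [TopologicalSpace X] (k : ℕ) : Set (Cohomology X) :=
  {z | ∃ f : cocycles X, VanishesBelow k (f : Cochain X) ∧
    Ideal.Quotient.mk (coboundaries X) f = z}

theorem mem_degreeFiltration_zero (z : Cohomology X) : z ∈ degreeFiltration X 0 := by
  obtain ⟨f, rfl⟩ := Ideal.Quotient.mk_surjective (I := coboundaries X) z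
  exact ⟨f, fun n hn ↦ absurd hn (Nat.not_lt_zero n), rfl⟩

theorem mul_mem_degreeFiltration {j k : ℕ} {y z : Cohomology X} (hy : y ∈ degreeFiltration X j)
    (hz : z ∈ degreeFiltration X k) : y * z ∈ degreeFiltration X (j + k) := by
  obtain ⟨f, hf, rfl⟩ := hy
  obtain ⟨g, hg, rfl⟩ := hz
  exact ⟨f * g, hf.mul hg, map_mul _ _ _⟩

theorem pow_mem_degreeFiltration {z : Cohomology X} (hz : z ∈ degreeFiltration X 1) (k : ℕ) :
    z ^ k ∈ degreeFiltration X k := by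
  induction k with
  | zero => exact mem_degreeFiltration_zero _
  | succ k ih => rw [pow_succ]; exact mul_mem_degreeFiltration ih hz

/-- A class is represented by a cochain of bounded degree, so it vanishes as soon as it can also be
represented in arbitrarily high degrees: a primitive of the difference may be truncated. -/
theorem eq_zero_of_forall_mem_degreeFiltration {z : Cohomology X}
    (h : ∀ k, z ∈ degreeFiltration X k) : z = 0 := by
  obtain ⟨g, rfl⟩ := Ideal.Quotient.mk_surjective (I := coboundaries X) z
  obtain ⟨M, hM⟩ := (g : Cochain X).app_bound
  obtain ⟨f, hf, hfg⟩ := h (M + 1)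
  obtain ⟨u, hu⟩ : g - f ∈ coboundaries X := Ideal.Quotient.eq.1 hfg.symm
  refine Ideal.Quotient.eq_zero_iff_mem.2 ⟨truncate M u, ?_⟩
  rw [coboundary_truncate, hu]
  refine Cochain.ext fun n σ ↦ ?_
  have hsub : ((g - f : cocycles X) : Cochain X).app n σ =
      (g : Cochain X).app n σ - (f : Cochain X).app n σ := rfl
  simp only [truncate, Cochain.app_mk, hsub]
  by_cases hn : n < M + 1
  · rw [if_pos hn, hf n hn, sub_zero]
  · rw [if_neg hn, hM n (by omega)]

/-- The singular `1`-simplex given by a path. -/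
def pathSimplex {x y : X} (γ : Path x y) : Simplex X 1 :=
  γ.toContinuousMap.comp
    ⟨stdSimplexHomeomorphUnitInterval, stdSimplexHomeomorphUnitInterval.continuous⟩

/-- A degree zero cocycle takes the same value at the two ends of every path. -/
theorem app_zero_eq_of_coboundary_eq_zero [PathConnectedSpace X] {f : Cochain X}
    (hf : Cochain.coboundary f = 0) (σ τ : Simplex X 0) : f.app 0 σ = f.app 0 τ := by
  let p : stdSimplex ℝ (Fin 1) := stdSimplex.vertex 0
  let γ : Path (σ p) (τ p) := PathConnectedSpace.somePath _ _
  have h : (Cochain.coboundary f).app 1 (pathSimplex γ) = 0 := by rw [hf]; rfl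
  have h1 : face (pathSimplex γ) 0 (skip 1) = σ := by
    ext q
    obtain rfl : q = p := Subsingleton.elim _ _
    have e : stdSimplexHomeomorphUnitInterval (stdSimplex.vertex 0) = 0 := rfl
    simp [face, pathSimplex, skip, p, e]
  have h0 : face (pathSimplex γ) 0 (skip 0) = τ := by
    ext q
    obtain rfl : q = p := Subsingleton.elim _ _
    have e : stdSimplexHomeomorphUnitInterval (stdSimplex.vertex 1) = 1 := rfl
    simp [face, pathSimplex, skip, p, e]
  rw [Cochain.app_coboundary_succ, Finset.sum_range_succ, Finset.sum_range_one, h0, h1] at h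
  simp only [pow_zero, one_mul, pow_one, neg_mul] at h
  exact (add_neg_eq_zero.1 h).symm

end SingularCohomology

namespace Cohomology

variable {X : Type*} [TopologicalSpace X]

theorem mem_degreeFiltration_one_of_restrict_eq_zero [PathConnectedSpace X] (x : X)
    {z : Cohomology X} (hz : restrict x z = 0) : z ∈ degreeFiltration X 1 := by
  obtain ⟨f, rfl⟩ := Ideal.Quotient.mk_surjective (I := coboundaries X) z
  refine ⟨f, fun n hn σ ↦ ?_, rfl⟩
  obtain rfl : n = 0 := by omega
  rw [app_zero_eq_of_coboundary_eq_zero f.2 σ (ContinuousMap.const _ x)]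
  exact hz

/-- Positive degree classes are nilpotent: by finite-dimensionality `z ^ k` is a multiple of
`z ^ (k + 1)` for some `k`, hence lies in every step of the degree filtration. -/
theorem isNilpotent_of_mem_degreeFiltration_one [FiniteDimensional ℂ (Cohomology X)]
    {z : Cohomology X} (hz : z ∈ degreeFiltration X 1) : IsNilpotent z := by
  obtain ⟨p, hp, hpz⟩ := Algebra.IsIntegral.isIntegral (R := ℂ) z
  obtain ⟨q, hq, hq0⟩ := Polynomial.exists_eq_pow_rootMultiplicity_mul_and_not_dvd p hp.ne_zero 0
  set k := p.rootMultiplicity 0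
  rw [Polynomial.C_0, sub_zero] at hq hq0
  rw [Polynomial.X_dvd_iff] at hq0
  have h0 : z ^ k * Polynomial.aeval z q = 0 := by
    have : Polynomial.aeval z p = 0 := hpz
    rwa [hq, map_mul, map_pow, Polynomial.aeval_X] at this
  -- `w` is a multiple of `z` with `z ^ k = z ^ k * w`
  set w : Cohomology X := z * (-(q.coeff 0)⁻¹ • Polynomial.aeval z q.divX) with hw
  have h1 : z ^ k = z ^ k * w := by
    rw [← Polynomial.X_mul_divX_add q, map_add, map_mul, Polynomial.aeval_X, Polynomial.aeval_C,
      mul_add, Algebra.algebraMap_eq_smul_one, mul_smul_comm, mul_one] at h0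
    rw [hw, mul_smul_comm, mul_smul_comm, eq_neg_of_add_eq_zero_left h0, smul_neg, neg_smul,
      neg_neg, smul_smul, inv_mul_cancel₀ hq0, one_smul]
  have h2 : ∀ j, z ^ k = z ^ k * w ^ j := by
    intro j
    induction j with
    | zero => simp
    | succ j ih => rw [pow_succ, ← mul_assoc, ← ih, ← h1]
  have hw1 : w ∈ degreeFiltration X 1 :=
    mul_mem_degreeFiltration hz (mem_degreeFiltration_zero _)
  refine ⟨k, eq_zero_of_forall_mem_degreeFiltration fun j ↦ ?_⟩
  rw [h2 j, ← zero_add j]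
  exact mul_mem_degreeFiltration (mem_degreeFiltration_zero _)
    (by simpa using pow_mem_degreeFiltration hw1 j)

theorem isNilpotent_degPos [Nonempty X] [PathConnectedSpace X]
    [FiniteDimensional ℂ (Cohomology X)] (α : Cohomology X) : IsNilpotent (degPos α) := by
  refine isNilpotent_of_mem_degreeFiltration_one
    (mem_degreeFiltration_one_of_restrict_eq_zero (Classical.arbitrary X) ?_)
  rw [degPos, map_sub, AlgHom.commutes]
  exact sub_self _

end Cohomology

/-! ### Values of functions at the sum of a scalar and a nilpotent element -/

section TaylorAlgebra

variable {H : Type*} [Ring H] [Algebra ℂ H]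

/-- The value `∑ₖ f⁽ᵏ⁾(z₀) / k! · bᵏ` of the function `f` at the sum of a scalar `z₀` and a
nilpotent element `b`. -/
noncomputable def taylorAt (z₀ : ℂ) (b : H) (f : ℂ → ℂ) : H :=
  ∑ k ∈ Finset.range (nilpotencyClass b), (iteratedDeriv k f z₀ / (k.factorial : ℂ)) • b ^ k

theorem taylorAt_eq_sum_range {N : ℕ} {b : H} (hN : b ^ N = 0) (z₀ : ℂ) (f : ℂ → ℂ) :
    taylorAt z₀ b f = ∑ k ∈ Finset.range N, (iteratedDeriv k f z₀ / (k.factorial : ℂ)) • b ^ k := by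
  have hle : nilpotencyClass b ≤ N := Nat.sInf_le hN
  refine Finset.sum_subset (Finset.range_mono hle) fun k _ hk ↦ ?_
  rw [pow_eq_zero_of_le (by simpa using hk) (pow_nilpotencyClass ⟨N, hN⟩), smul_zero]

variable {b : H} {z₀ : ℂ}

theorem taylorAt_congr {f g : ℂ → ℂ} (h : f =ᶠ[𝓝 z₀] g) : taylorAt z₀ b f = taylorAt z₀ b g := by
  refine Finset.sum_congr rfl fun k _ ↦ ?_
  rw [Filter.EventuallyEq.iteratedDeriv_eq k h]

theorem taylorAt_const (hb : IsNilpotent b) (c : ℂ) :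
    taylorAt z₀ b (fun _ ↦ c) = algebraMap ℂ H c := by
  obtain ⟨N, hN⟩ := hb
  rw [taylorAt_eq_sum_range (N := N + 1) (by rw [pow_succ, hN, zero_mul]),
    Finset.sum_range_succ', Finset.sum_eq_zero]
  · simp [Algebra.algebraMap_eq_smul_one]
  · intro k _
    simp [iteratedDeriv_const]

theorem taylorAt_const_mul (c : ℂ) (f : ℂ → ℂ) :
    taylorAt z₀ b (fun z ↦ c * f z) = c • taylorAt z₀ b f := by
  rw [taylorAt, taylorAt, Finset.smul_sum]
  refine Finset.sum_congr rfl fun k _ ↦ ?_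
  rw [show (fun z ↦ c * f z) = c • f from rfl, iteratedDeriv_const_smul_field, smul_smul,
    smul_eq_mul, mul_div_assoc]

theorem taylorAt_add {f g : ℂ → ℂ} (hf : AnalyticAt ℂ f z₀) (hg : AnalyticAt ℂ g z₀) :
    taylorAt z₀ b (fun z ↦ f z + g z) = taylorAt z₀ b f + taylorAt z₀ b g := by
  rw [taylorAt, taylorAt, taylorAt, ← Finset.sum_add_distrib]
  refine Finset.sum_congr rfl fun k _ ↦ ?_
  rw [iteratedDeriv_fun_add hf.contDiffAt hg.contDiffAt, add_div, add_smul]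

theorem taylorAt_sub {f g : ℂ → ℂ} (hf : AnalyticAt ℂ f z₀) (hg : AnalyticAt ℂ g z₀) :
    taylorAt z₀ b (fun z ↦ f z - g z) = taylorAt z₀ b f - taylorAt z₀ b g := by
  rw [taylorAt, taylorAt, taylorAt, ← Finset.sum_sub_distrib]
  refine Finset.sum_congr rfl fun k _ ↦ ?_
  rw [iteratedDeriv_fun_sub hf.contDiffAt hg.contDiffAt, sub_div, sub_smul]

theorem taylorAt_sum (hb : IsNilpotent b) {ι : Type*} (t : Finset ι) {f : ι → ℂ → ℂ}
    (hf : ∀ i, AnalyticAt ℂ (f i) z₀) :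
    taylorAt z₀ b (fun z ↦ ∑ i ∈ t, f i z) = ∑ i ∈ t, taylorAt z₀ b (f i) := by
  classical
  induction t using Finset.induction_on with
  | empty => simpa using taylorAt_const (z₀ := z₀) hb 0
  | insert i t hi ih =>
    simp only [Finset.sum_insert hi]
    rw [taylorAt_add (hf i) (Finset.analyticAt_fun_sum t fun i _ ↦ hf i), ih]

theorem taylorAt_mul (hb : IsNilpotent b) {f g : ℂ → ℂ} (hf : AnalyticAt ℂ f z₀)
    (hg : AnalyticAt ℂ g z₀) :
    taylorAt z₀ b (fun z ↦ f z * g z) = taylorAt z₀ b f * taylorAt z₀ b g := by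
  obtain ⟨N, hN⟩ := hb
  simp only [taylorAt_eq_sum_range hN]
  rw [Finset.sum_mul_sum, ← Finset.sum_product']
  have hz : ∀ p ∈ Finset.range N ×ˢ Finset.range N, p ∉ {p ∈ Finset.range N ×ˢ Finset.range N |
      p.1 + p.2 < N} → (iteratedDeriv p.1 f z₀ / (p.1.factorial : ℂ)) • b ^ p.1 *
        (iteratedDeriv p.2 g z₀ / (p.2.factorial : ℂ)) • b ^ p.2 = 0 := by
    intro p hp hp'
    rw [smul_mul_smul_comm, ← pow_add, pow_eq_zero_of_le _ hN, smul_zero]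
    simp only [Finset.mem_filter, not_and, not_lt] at hp'
    exact hp' hp
  rw [← Finset.sum_subset (Finset.filter_subset _ _) hz]
  have hterm : ∀ k ∈ Finset.range N,
      (iteratedDeriv k (fun z ↦ f z * g z) z₀ / (k.factorial : ℂ)) • b ^ k =
      ∑ i ∈ Finset.range (k + 1), (iteratedDeriv i f z₀ / (i.factorial : ℂ)) • b ^ i *
        (iteratedDeriv (k - i) g z₀ / ((k - i).factorial : ℂ)) • b ^ (k - i) := by
    intro k _
    rw [iteratedDeriv_fun_mul hf.contDiffAt hg.contDiffAt, Finset.sum_div, Finset.sum_smul]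
    refine Finset.sum_congr rfl fun i hi ↦ ?_
    have hik : i ≤ k := Nat.lt_succ_iff.1 (Finset.mem_range.1 hi)
    rw [smul_mul_smul_comm, ← pow_add, Nat.add_sub_cancel' hik, Nat.cast_choose ℂ hik]
    congr 1
    have h1 : (k.factorial : ℂ) ≠ 0 := Nat.cast_ne_zero.2 k.factorial_ne_zero
    field_simp
  rw [Finset.sum_congr rfl hterm, Finset.sum_sigma']
  refine Finset.sum_nbij' (fun x ↦ (x.2, x.1 - x.2)) (fun p ↦ ⟨p.1 + p.2, p.1⟩) ?_ ?_ ?_ ?_ ?_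
  · rintro ⟨k, i⟩ h
    simp only [Finset.mem_sigma, Finset.mem_range, Finset.mem_filter, Finset.mem_product] at h ⊢
    omega
  · rintro ⟨k, i⟩ h
    simp only [Finset.mem_sigma, Finset.mem_range, Finset.mem_filter, Finset.mem_product] at h ⊢
    omega
  · rintro ⟨k, i⟩ h
    simp only [Finset.mem_sigma, Finset.mem_range] at h
    simp only [Sigma.mk.injEq, heq_eq_eq, and_true]
    omega
  · rintro ⟨k, i⟩ h
    simp
  · rintro ⟨k, i⟩ h
    rfl

theorem taylorAt_const_add (hb : IsNilpotent b) (c : ℂ) :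
    taylorAt z₀ b (fun z ↦ c + z) = algebraMap ℂ H (c + z₀) + b := by
  obtain ⟨N, hN⟩ := hb
  rw [taylorAt_eq_sum_range (N := N + 2) (by rw [pow_add, hN, zero_mul]),
    Finset.sum_range_succ', Finset.sum_range_succ', Finset.sum_eq_zero]
  · simp [iteratedDeriv_one, Algebra.algebraMap_eq_smul_one, add_comm]
  · intro k _
    have : iteratedDeriv (k + 1 + 1) (fun z : ℂ ↦ c + z) z₀ = 0 := by
      rw [iteratedDeriv_succ', iteratedDeriv_succ']
      simp
    rw [this]
    simp

theorem taylorAt_mul_eq_sum (f : ℂ → ℂ) (ρ : H) : taylorAt z₀ b f * ρ =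
    ∑ k ∈ Finset.range (nilpotencyClass b), b ^ k *
      ((iteratedDeriv k f z₀ / (k.factorial : ℂ)) • ρ) := by
  simp only [taylorAt, Finset.sum_mul, smul_mul_assoc, mul_smul_comm]

end TaylorAlgebra

/-! ### Cauchy estimates and infinite sums of such values -/

section TaylorBounds

/-- Cauchy's estimate for Taylor coefficients, on the circle of radius `1 / 2`. -/
theorem norm_iteratedDeriv_div_factorial_le {f : ℂ → ℂ} {z₀ : ℂ} {M : ℝ}
    (hf : DifferentiableOn ℂ f (Metric.ball z₀ 1)) (hM : ∀ z ∈ Metric.ball z₀ 1, ‖f z‖ ≤ M)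
    (k : ℕ) : ‖iteratedDeriv k f z₀ / (k.factorial : ℂ)‖ ≤ 2 ^ k * M := by
  have hsub : Metric.closedBall z₀ (1 / 2) ⊆ Metric.ball z₀ 1 :=
    Metric.closedBall_subset_ball (by norm_num)
  have h := Complex.norm_iteratedDeriv_le_of_forall_mem_sphere_norm_le (f := f) (c := z₀)
    (R := 1 / 2) (C := M) k (by norm_num)
    (DifferentiableOn.diffContOnCl
      (hf.mono ((closure_mono Metric.ball_subset_closedBall).trans
        (by rwa [Metric.isClosed_closedBall.closure_eq]))))
    (fun z hz ↦ hM z (hsub (Metric.sphere_subset_closedBall hz)))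
  rw [norm_div, Complex.norm_natCast, div_le_iff₀ (by positivity)]
  refine h.trans (le_of_eq ?_)
  rw [one_div, inv_pow, div_inv_eq_mul]
  ring

variable {H : Type*} [Ring H] [Algebra ℂ H] [TopologicalSpace H] [IsTopologicalAddGroup H]
  [ContinuousSMul ℂ H] {b : H} {z₀ : ℂ}

/-- Convergence to zero near `z₀` of holomorphic functions passes to their values at `z₀ + b`. -/
theorem tendsto_taylorAt_zero {ι : Type*} {l : Filter ι} {F : ι → ℂ → ℂ} {M : ι → ℝ}
    (hF : ∀ᶠ i in l, DifferentiableOn ℂ (F i) (Metric.ball z₀ 1))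
    (hM : ∀ᶠ i in l, ∀ z ∈ Metric.ball z₀ 1, ‖F i z‖ ≤ M i) (h0 : Tendsto M l (𝓝 0)) :
    Tendsto (fun i ↦ taylorAt z₀ b (F i)) l (𝓝 0) := by
  have hc : ∀ k : ℕ, Tendsto (fun i ↦ iteratedDeriv k (F i) z₀ / (k.factorial : ℂ)) l (𝓝 0) := by
    intro k
    refine squeeze_zero_norm' (a := fun i ↦ 2 ^ k * M i) ?_ (by simpa using h0.const_mul (2 ^ k))
    filter_upwards [hF, hM] with i hi hi'
    exact norm_iteratedDeriv_div_factorial_le hi hi' k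
  have := tendsto_finsetSum (Finset.range (nilpotencyClass b)) fun k _ ↦
    (hc k).smul_const (b ^ k)
  simpa [taylorAt] using this

theorem hasSum_taylorAt (hb : IsNilpotent b) {f : ℕ → ℂ → ℂ} {M : ℕ → ℝ}
    (hf : ∀ n, DifferentiableOn ℂ (f n) (Metric.ball z₀ 1))
    (hM : ∀ n, ∀ z ∈ Metric.ball z₀ 1, ‖f n z‖ ≤ M n) (hs : Summable M) :
    HasSum (fun n ↦ taylorAt z₀ b (f n)) (taylorAt z₀ b (fun z ↦ ∑' n, f n z)) := by
  have hnhds : Metric.ball z₀ 1 ∈ 𝓝 z₀ := Metric.ball_mem_nhds _ one_pos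
  have hd : DifferentiableOn ℂ (fun z ↦ ∑' n, f n z) (Metric.ball z₀ 1) :=
    Complex.differentiableOn_tsum_of_summable_norm hs hf Metric.isOpen_ball hM
  have key : Tendsto (fun t : Finset ℕ ↦
      taylorAt z₀ b (fun z ↦ (∑' n, f n z) - ∑ n ∈ t, f n z)) atTop (𝓝 0) := by
    refine tendsto_taylorAt_zero (M := fun t ↦ (∑' n, M n) - ∑ n ∈ t, M n)
      (.of_forall fun t ↦ hd.sub (DifferentiableOn.fun_sum fun n _ ↦ hf n)) (.of_forall ?_) ?_
    · intro t z hz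
      have h1 : Summable fun n ↦ f n z := hs.of_norm_bounded fun n ↦ hM n z hz
      rw [← h1.sum_add_tsum_subtype_compl t, ← hs.sum_add_tsum_subtype_compl t, add_sub_cancel_left,
        add_sub_cancel_left]
      exact tsum_of_norm_bounded (hs.subtype _).hasSum fun n ↦ hM n z hz
    · simpa using Tendsto.const_sub (∑' n, M n) hs.hasSum
  have h2 : ∀ t : Finset ℕ, taylorAt z₀ b (fun z ↦ (∑' n, f n z) - ∑ n ∈ t, f n z) =
      taylorAt z₀ b (fun z ↦ ∑' n, f n z) - ∑ n ∈ t, taylorAt z₀ b (f n) := by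
    intro t
    rw [taylorAt_sub (hd.analyticAt hnhds) (Finset.analyticAt_fun_sum t fun n _ ↦
      (hf n).analyticAt hnhds), taylorAt_sum hb t fun n ↦ (hf n).analyticAt hnhds]
  simp only [h2] at key
  have := key.const_sub (taylorAt z₀ b (fun z ↦ ∑' n, f n z))
  simpa [HasSum] using this

end TaylorBounds

/-! ### Weighted sums of null sequences -/

section Toeplitz

theorem summable_smul_of_tendsto_of_normed {V : Type*} [NormedAddCommGroup V] [NormedSpace ℂ V]
    [CompleteSpace V] {c : ℕ → ℂ} {ρ : ℕ → V} {v : V} (hc : Summable fun n ↦ ‖c n‖)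
    (hρ : Tendsto ρ atTop (𝓝 v)) : Summable fun n ↦ c n • ρ n := by
  obtain ⟨D, hD⟩ := hρ.norm.bddAbove_range
  refine (hc.mul_right D).of_norm_bounded fun n ↦ ?_
  rw [norm_smul]
  exact mul_le_mul_of_nonneg_left (hD ⟨n, rfl⟩) (norm_nonneg _)

theorem tendsto_tsum_smul_zero_of_normed {V : Type*} [NormedAddCommGroup V] [NormedSpace ℂ V]
    [CompleteSpace V] {ι : Type*} {l : Filter ι} {c : ℕ → ι → ℂ} {M : ℕ → ι → ℝ} {C : ℝ}
    {ρ : ℕ → V} (hc : ∀ᶠ i in l, ∀ n, ‖c n i‖ ≤ M n i) (hs : ∀ᶠ i in l, Summable fun n ↦ M n i)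
    (hC : ∀ᶠ i in l, ∑' n, M n i ≤ C) (hM : ∀ n, Tendsto (M n) l (𝓝 0))
    (hρ : Tendsto ρ atTop (𝓝 0)) : Tendsto (fun i ↦ ∑' n, c n i • ρ n) l (𝓝 0) := by
  rw [Metric.tendsto_nhds]
  intro ε hε
  obtain ⟨D, hD⟩ := hρ.norm.bddAbove_range
  set δ : ℝ := ε / (2 * (|C| + 1)) with hδ
  have hδ0 : 0 < δ := by positivity
  obtain ⟨N, hN⟩ := (Metric.tendsto_atTop.1 hρ) δ hδ0
  have hfin : Tendsto (fun i ↦ ∑ n ∈ Finset.range N, M n i * D) l (𝓝 0) := by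
    simpa using tendsto_finsetSum (Finset.range N) fun n _ ↦ (hM n).mul_const D
  filter_upwards [hc, hs, hC, hfin.eventually (gt_mem_nhds (half_pos hε))] with i h1 h2 h3 h4
  have hM0 : ∀ n, 0 ≤ M n i := fun n ↦ (norm_nonneg _).trans (h1 n)
  have hD0 : 0 ≤ D := (norm_nonneg _).trans (hD ⟨0, rfl⟩)
  have hb : ∀ n, ‖c n i • ρ n‖ ≤ (if n < N then M n i * D else 0) + M n i * δ := by
    intro n
    rw [norm_smul]
    split_ifs with hn
    · exact (mul_le_mul (h1 n) (hD ⟨n, rfl⟩) (norm_nonneg _) (hM0 n)).trans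
        (le_add_of_nonneg_right (mul_nonneg (hM0 n) hδ0.le))
    · rw [zero_add]
      have := hN n (not_lt.1 hn)
      rw [dist_zero_right] at this
      exact mul_le_mul (h1 n) this.le (norm_nonneg _) (hM0 n)
  -- the first `N` terms are small because their weights are, the others because `ρ` is
  have hsum1 : HasSum (fun n ↦ if n < N then M n i * D else 0)
      (∑ n ∈ Finset.range N, M n i * D) := by
    have := hasSum_sum_of_ne_finset_zero (L := .unconditional ℕ)
      (f := fun n ↦ if n < N then M n i * D else 0)
      (s := Finset.range N) (fun n hn ↦ if_neg (by simpa using hn))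
    rwa [Finset.sum_congr rfl (fun n hn ↦ if_pos (Finset.mem_range.1 hn))] at this
  have hle := tsum_of_norm_bounded (hsum1.add (h2.hasSum.mul_right δ)) hb
  rw [dist_zero_right]
  have : (∑' n, M n i) * δ ≤ ε / 2 * (|C| / (|C| + 1)) := by
    calc (∑' n, M n i) * δ ≤ |C| * δ := by gcongr; exact h3.trans (le_abs_self C)
      _ = _ := by rw [hδ]; field_simp
  have h5 : |C| / (|C| + 1) ≤ 1 := (div_le_one (by positivity)).2 (by linarith)
  nlinarith

variable {V : Type*} [AddCommGroup V] [Module ℂ V] [TopologicalSpace V] [IsTopologicalAddGroup V]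
  [ContinuousSMul ℂ V] [T2Space V] [FiniteDimensional ℂ V]

theorem summable_smul_of_tendsto {c : ℕ → ℂ} {ρ : ℕ → V} {v : V} (hc : Summable fun n ↦ ‖c n‖)
    (hρ : Tendsto ρ atTop (𝓝 v)) : Summable fun n ↦ c n • ρ n := by
  let e := (Module.finBasis ℂ V).equivFunL
  have h := summable_smul_of_tendsto_of_normed hc ((e.continuous.tendsto v).comp hρ)
  simpa using h.mapL e.symm.toContinuousLinearMap

/-- A Toeplitz type lemma: averages, with weights that are uniformly bounded in `ℓ¹` and tend to
zero individually, of a null sequence in a finite-dimensional space tend to zero. -/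
theorem tendsto_tsum_smul_zero {ι : Type*} {l : Filter ι} {c : ℕ → ι → ℂ} {M : ℕ → ι → ℝ} {C : ℝ}
    {ρ : ℕ → V} (hc : ∀ᶠ i in l, ∀ n, ‖c n i‖ ≤ M n i) (hs : ∀ᶠ i in l, Summable fun n ↦ M n i)
    (hC : ∀ᶠ i in l, ∑' n, M n i ≤ C) (hM : ∀ n, Tendsto (M n) l (𝓝 0))
    (hρ : Tendsto ρ atTop (𝓝 0)) : Tendsto (fun i ↦ ∑' n, c n i • ρ n) l (𝓝 0) := by
  let e := (Module.finBasis ℂ V).equivFunL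
  have h := tendsto_tsum_smul_zero_of_normed hc hs hC hM
    (by simpa [Function.comp_def] using (e.continuous.tendsto 0).comp hρ :
      Tendsto (fun n ↦ e (ρ n)) atTop (𝓝 0))
  have h' := (e.symm.continuous.tendsto 0).comp h
  rw [map_zero] at h'
  refine h'.congr fun i ↦ ?_
  simp only [Function.comp, ← map_smul, ← e.map_tsum, e.symm_apply_apply]

end Toeplitz

/-! ### Series with coefficients in a finite-dimensional algebra -/

section TaylorToeplitz

variable {H : Type*} [Ring H] [Algebra ℂ H] [TopologicalSpace H] [IsTopologicalAddGroup H]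
  [ContinuousSMul ℂ H] [T2Space H] [FiniteDimensional ℂ H] {b : H} {z₀ : ℂ}

theorem continuous_const_mul_of_finiteDimensional (h : H) : Continuous fun x : H ↦ h * x :=
  (LinearMap.mulLeft ℂ h).continuous_of_finiteDimensional

theorem tendsto_const_mul {ι : Type*} {l : Filter ι} {f : ι → H} {a : H} (h : H)
    (hf : Tendsto f l (𝓝 a)) : Tendsto (fun i ↦ h * f i) l (𝓝 (h * a)) :=
  ((continuous_const_mul_of_finiteDimensional h).tendsto a).comp hf

theorem HasSum.const_mul_of_finiteDimensional {ι : Type*} {f : ι → H} {a : H} (h : H)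
    (hf : HasSum f a) : HasSum (fun i ↦ h * f i) (h * a) :=
  hf.mapL ⟨LinearMap.mulLeft ℂ h, continuous_const_mul_of_finiteDimensional h⟩

theorem HasSum.mul_const_of_finiteDimensional {ι : Type*} {f : ι → H} {a : H} (h : H)
    (hf : HasSum f a) : HasSum (fun i ↦ f i * h) (a * h) :=
  hf.mapL ⟨LinearMap.mulRight ℂ h, (LinearMap.mulRight ℂ h).continuous_of_finiteDimensional⟩

theorem hasSum_taylorAt_mul {f : ℕ → ℂ → ℂ} {M : ℕ → ℝ} {ρ : ℕ → H} {v : H}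
    (hf : ∀ n, DifferentiableOn ℂ (f n) (Metric.ball z₀ 1))
    (hM : ∀ n, ∀ z ∈ Metric.ball z₀ 1, ‖f n z‖ ≤ M n) (hs : Summable M)
    (hρ : Tendsto ρ atTop (𝓝 v)) :
    HasSum (fun n ↦ taylorAt z₀ b (f n) * ρ n)
      (∑ k ∈ Finset.range (nilpotencyClass b), b ^ k *
        ∑' n, (iteratedDeriv k (f n) z₀ / (k.factorial : ℂ)) • ρ n) := by
  simp only [taylorAt_mul_eq_sum]
  refine hasSum_sum fun k _ ↦ (Summable.hasSum ?_).const_mul_of_finiteDimensional _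
  refine summable_smul_of_tendsto ?_ hρ
  exact Summable.of_nonneg_of_le (fun _ ↦ norm_nonneg _)
    (fun n ↦ norm_iteratedDeriv_div_factorial_le (hf n) (hM n) k) (hs.mul_left _)

theorem tendsto_tsum_taylorAt_mul_zero {ι : Type*} {l : Filter ι} {f : ℕ → ι → ℂ → ℂ}
    {M : ℕ → ι → ℝ} {C : ℝ} {ρ : ℕ → H}
    (hf : ∀ n i, DifferentiableOn ℂ (f n i) (Metric.ball z₀ 1))
    (hM : ∀ᶠ i in l, ∀ n, ∀ z ∈ Metric.ball z₀ 1, ‖f n i z‖ ≤ M n i)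
    (hs : ∀ᶠ i in l, Summable fun n ↦ M n i) (hC : ∀ᶠ i in l, ∑' n, M n i ≤ C)
    (h0 : ∀ n, Tendsto (M n) l (𝓝 0)) (hρ : Tendsto ρ atTop (𝓝 0)) :
    Tendsto (fun i ↦ ∑' n, taylorAt z₀ b (f n i) * ρ n) l (𝓝 0) := by
  have h : Tendsto (fun i ↦ ∑ k ∈ Finset.range (nilpotencyClass b), b ^ k *
      ∑' n, (iteratedDeriv k (f n i) z₀ / (k.factorial : ℂ)) • ρ n) l (𝓝 0) := by
    rw [← Finset.sum_const_zero (s := Finset.range (nilpotencyClass b))]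
    refine tendsto_finsetSum _ fun k _ ↦ ?_
    rw [← mul_zero (b ^ k)]
    refine tendsto_const_mul _ (tendsto_tsum_smul_zero (M := fun n i ↦ 2 ^ k * M n i)
      (C := 2 ^ k * C) ?_ ?_ ?_ ?_ hρ)
    · filter_upwards [hM] with i hi n
      exact norm_iteratedDeriv_div_factorial_le (hf n i) (hi n) k
    · filter_upwards [hs] with i hi using hi.mul_left _
    · filter_upwards [hC] with i hi
      rw [tsum_mul_left]
      gcongr
    · intro n
      simpa using (h0 n).const_mul (2 ^ k)
  refine h.congr' ?_
  filter_upwards [hM, hs] with i h1 h2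
  exact (hasSum_taylorAt_mul (fun n ↦ hf n i) h1 h2 hρ).tsum_eq.symm

end TaylorToeplitz

/-! ### Functions negligible compared with the exponential function -/

section Negligible

/-- `E(x) = o(xᵃ eˣ)` for all `a`. -/
def IsExpNegligible (E : ℝ → ℝ) : Prop :=
  ∀ L : ℕ, Tendsto (fun x ↦ E x * x ^ L * Real.exp (-x)) atTop (𝓝 0)

theorem IsExpNegligible.add {E F : ℝ → ℝ} (hE : IsExpNegligible E) (hF : IsExpNegligible F) :
    IsExpNegligible fun x ↦ E x + F x := by
  intro L
  simpa [add_mul] using (hE L).add (hF L)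

theorem IsExpNegligible.const_mul {E : ℝ → ℝ} (hE : IsExpNegligible E) (c : ℝ) :
    IsExpNegligible fun x ↦ c * E x := by
  intro L
  simpa [mul_assoc] using (hE L).const_mul c

theorem IsExpNegligible.sum {ι : Type*} {s : Finset ι} {E : ι → ℝ → ℝ}
    (h : ∀ i ∈ s, IsExpNegligible (E i)) : IsExpNegligible fun x ↦ ∑ i ∈ s, E i x := by
  intro L
  simpa [Finset.sum_mul] using tendsto_finsetSum s fun i hi ↦ h i hi L

theorem isExpNegligible_exp_mul_rpow {c : ℝ} (hc : c < 1) (p : ℝ) :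
    IsExpNegligible fun x ↦ Real.exp (c * x) * x ^ p := by
  intro L
  refine (tendsto_rpow_mul_exp_neg_mul_atTop_nhds_zero (p + L) (1 - c) (sub_pos.2 hc)).congr' ?_
  filter_upwards [eventually_gt_atTop 0] with x hx
  rw [Real.rpow_add hx, Real.rpow_natCast, show -(1 - c) * x = c * x + -x by ring, Real.exp_add]
  ring

theorem isExpNegligible_rpow (p : ℝ) : IsExpNegligible fun x ↦ x ^ p := by
  simpa using isExpNegligible_exp_mul_rpow (c := 0) zero_lt_one p

theorem isExpNegligible_pow (n : ℕ) : IsExpNegligible fun x ↦ x ^ n := by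
  simpa using isExpNegligible_rpow n

end Negligible

/-! ### Majorants for the terms `x^{n+z} / Γ(1+n+z)` -/

section GammaBounds

/-- A consequence of the convexity of `log Γ`. -/
theorem factorial_mul_rpow_le_Gamma {σ : ℝ} (hσ : 1 < σ) (m : ℕ) :
    (m.factorial : ℝ) * ((m : ℝ) + 1) ^ σ ≤ Real.Gamma (1 + σ + m) := by
  have h := Real.BohrMollerup.f_add_nat_ge (f := Real.log ∘ Real.Gamma)
    Real.convexOn_log_Gamma (fun {y} hy ↦ by
      simp only [Function.comp]
      rw [Real.Gamma_add_one hy.ne', Real.log_mul hy.ne' (Real.Gamma_pos_of_pos hy).ne', add_comm])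
    (n := m + 2) (by omega) (x := σ - 1) (sub_pos.2 hσ)
  simp only [Function.comp] at h
  have h2 : ((m + 2 : ℕ) : ℝ) + (σ - 1) = 1 + σ + m := by push_cast; ring
  have h3 : ((m + 2 : ℕ) : ℝ) = ((m + 1 : ℕ) : ℝ) + 1 := by push_cast; ring
  rw [h2, h3, Real.Gamma_nat_eq_factorial, add_sub_cancel_right] at h
  have hm : (0 : ℝ) < ((m + 1 : ℕ) : ℝ) := by positivity
  have hG : 0 < Real.Gamma (1 + σ + m) := Real.Gamma_pos_of_pos (by positivity)
  rw [← Real.exp_le_exp, Real.exp_add, Real.exp_log (by positivity), Real.exp_log hG,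
    mul_comm (σ - 1), ← Real.rpow_def_of_pos hm, Nat.factorial_succ] at h
  refine le_trans (le_of_eq ?_) h
  rw [show σ = 1 + (σ - 1) by ring, Real.rpow_add (by positivity), Real.rpow_one]
  push_cast
  ring_nf

/-- Passing from `Γ(1 + w)` to `Γ(1 + w + m)`, the modulus of `Γ` grows at least as fast as on the
real axis, because `|w + j| ≥ Re w + j`. -/
theorem norm_inv_Gamma_add_nat_le {w : ℂ} (hw : 0 < w.re) (m : ℕ) :
    ‖(Complex.Gamma (1 + w + m))⁻¹‖ ≤
      Real.Gamma (1 + w.re) * ‖(Complex.Gamma (1 + w))⁻¹‖ * (Real.Gamma (1 + w.re + m))⁻¹ := by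
  induction m with
  | zero =>
    have : Real.Gamma (1 + w.re) ≠ 0 := (Real.Gamma_pos_of_pos (by positivity)).ne'
    simp only [Nat.cast_zero, add_zero]
    field_simp
    rfl
  | succ m ih =>
    have h0 : (1 + w + m : ℂ) ≠ 0 := by
      intro h
      have := congrArg Complex.re h
      simp only [Complex.add_re, Complex.one_re, Complex.natCast_re, Complex.zero_re] at this
      have hm : (0 : ℝ) ≤ m := m.cast_nonneg
      linarith
    have h1 : (0 : ℝ) < 1 + w.re + m := by positivity
    have hle : 1 + w.re + m ≤ ‖(1 + w + m : ℂ)‖ := by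
      refine le_trans (le_of_eq ?_) (Complex.re_le_norm _)
      simp
    have e1 : (1 + w + ((m + 1 : ℕ) : ℂ)) = (1 + w + m) + 1 := by push_cast; ring
    have e2 : (1 + w.re + ((m + 1 : ℕ) : ℝ)) = (1 + w.re + m) + 1 := by push_cast; ring
    rw [e1, e2, Complex.Gamma_add_one _ h0, Real.Gamma_add_one h1.ne', mul_inv, mul_inv, norm_mul,
      norm_inv]
    calc ‖(1 + w + m : ℂ)‖⁻¹ * ‖(Complex.Gamma (1 + w + m))⁻¹‖
        ≤ (1 + w.re + m)⁻¹ * (Real.Gamma (1 + w.re) * ‖(Complex.Gamma (1 + w))⁻¹‖ *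
          (Real.Gamma (1 + w.re + m))⁻¹) := by gcongr
      _ = _ := by ring

/-- The function `x^{n+z} / Γ(1+n+z)` of `z`; its value at `β` is a coefficient of a Mittag-Leffler
series. -/
noncomputable def mlTerm (n : ℕ) (x : ℝ) (z : ℂ) : ℂ :=
  Complex.exp (Real.log x * (n + z)) * (Complex.Gamma (1 + n + z))⁻¹

theorem differentiable_mlTerm (n : ℕ) (x : ℝ) : Differentiable ℂ (mlTerm n x) := by
  refine Differentiable.mul (by fun_prop) ?_
  exact Complex.differentiable_one_div_Gamma.comp (f := fun z : ℂ ↦ 1 + n + z) (by fun_prop)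

theorem mlTerm_add_nat (n N : ℕ) (x : ℝ) (z : ℂ) : mlTerm (n + N) x z = mlTerm n x (N + z) := by
  unfold mlTerm
  push_cast
  congr 3 <;> ring

/-- Raising the exponent by one: `x^{n+z} / Γ(1+n+z) = x⁻¹ (n+z+1) x^{n+z+1} / Γ(n+z+2)`. -/
theorem mlTerm_eq_inv_mul (n : ℕ) {x : ℝ} (hx : 0 < x) (z : ℂ) :
    mlTerm n x z = (x : ℂ)⁻¹ * ((n + z + 1) * mlTerm n x (z + 1)) := by
  unfold mlTerm
  have hx' : (x : ℂ) ≠ 0 := Complex.ofReal_ne_zero.2 hx.ne'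
  rw [Complex.one_div_Gamma_eq_self_mul_one_div_Gamma_add_one (1 + n + z),
    show (Real.log x : ℂ) * (n + (z + 1)) = Real.log x * (n + z) + Real.log x by ring,
    Complex.exp_add, ← Complex.ofReal_exp, Real.exp_log hx,
    show (1 + n + z + 1 : ℂ) = 1 + n + (z + 1) by ring]
  field_simp
  ring

theorem norm_mlTerm {x : ℝ} (hx : 0 < x) (n : ℕ) (z : ℂ) :
    ‖mlTerm n x z‖ = x ^ (n + z.re) * ‖(Complex.Gamma (1 + n + z))⁻¹‖ := by
  rw [mlTerm, norm_mul, Complex.norm_exp, Real.rpow_def_of_pos hx]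
  simp

/-- The factor `(x / (m + 1)) ^ Re w`, by which `x^{w+m} / Γ(1+w+m)` differs from `x^m / m!`, is at
most `1 + (x / (m + 1)) ^ K`; so the term is bounded by two terms of the exponential series. -/
theorem norm_mlTerm_le {w : ℂ} (hw : 1 < w.re) {K : ℕ} (hK : w.re ≤ K) {x : ℝ} (hx : 0 < x)
    (m : ℕ) : ‖mlTerm m x w‖ ≤ Real.Gamma (1 + w.re) * ‖(Complex.Gamma (1 + w))⁻¹‖ *
      (x ^ m / m.factorial + (K + 1) ^ K * (x ^ (m + K) / (m + K).factorial)) := by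
  set σ := w.re with hσ
  have hσ0 : 0 < σ := by linarith
  have hQ : 0 ≤ Real.Gamma (1 + σ) * ‖(Complex.Gamma (1 + w))⁻¹‖ :=
    mul_nonneg (Real.Gamma_pos_of_pos (by positivity)).le (norm_nonneg _)
  have h1 := norm_inv_Gamma_add_nat_le hσ0 m
  rw [norm_mlTerm hx, show (1 + m + w : ℂ) = 1 + w + m by ring]
  have hpos : (0 : ℝ) < (m.factorial : ℝ) * ((m : ℝ) + 1) ^ σ := by positivity
  have h2 : x ^ (m + σ) * (Real.Gamma (1 + σ + m))⁻¹ ≤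
      x ^ m / m.factorial + (K + 1) ^ K * (x ^ (m + K) / (m + K).factorial) := by
    have ha : x ^ (m + σ) * (Real.Gamma (1 + σ + m))⁻¹ ≤
        x ^ m / m.factorial * (x / (m + 1)) ^ σ := by
      calc x ^ (m + σ) * (Real.Gamma (1 + σ + m))⁻¹
          ≤ x ^ (m + σ) * ((m.factorial : ℝ) * ((m : ℝ) + 1) ^ σ)⁻¹ := by
            gcongr
            exact factorial_mul_rpow_le_Gamma hw m
        _ = _ := by
            rw [Real.rpow_add hx, Real.rpow_natCast, Real.div_rpow hx.le (by positivity)]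
            field_simp
    have hb : (x / (m + 1)) ^ σ ≤ 1 + (x / (m + 1)) ^ K := by
      have hy : 0 < x / ((m : ℝ) + 1) := by positivity
      rcases le_total (x / ((m : ℝ) + 1)) 1 with h | h
      · exact (Real.rpow_le_one hy.le h hσ0.le).trans (le_add_of_nonneg_right (by positivity))
      · rw [← Real.rpow_natCast]
        exact (Real.rpow_le_rpow_of_exponent_le h hK).trans (le_add_of_nonneg_left zero_le_one)
    have hc : ((m + K).factorial : ℝ) ≤ m.factorial * ((K + 1) * (m + 1)) ^ K := by
      have h3 : (m + K).factorial ≤ m.factorial * ((K + 1) * (m + 1)) ^ K := by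
        rw [← Nat.factorial_mul_ascFactorial]
        refine Nat.mul_le_mul_left _ ((Nat.ascFactorial_le_pow_add m K).trans ?_)
        exact Nat.pow_le_pow_left (by nlinarith) K
      exact_mod_cast h3
    refine ha.trans ((mul_le_mul_of_nonneg_left hb (by positivity)).trans ?_)
    rw [mul_add, mul_one]
    refine add_le_add_right ?_ _
    calc x ^ m / m.factorial * (x / (m + 1)) ^ K
        = (K + 1) ^ K * (x ^ (m + K) / (m.factorial * ((K + 1) * (m + 1)) ^ K)) := by
          rw [div_pow, pow_add, mul_pow]
          field_simp
      _ ≤ _ := by gcongr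
  calc x ^ (m + σ) * ‖(Complex.Gamma (1 + w + m))⁻¹‖
      ≤ x ^ (m + σ) * (Real.Gamma (1 + σ) * ‖(Complex.Gamma (1 + w))⁻¹‖ *
        (Real.Gamma (1 + σ + m))⁻¹) := by gcongr
    _ = Real.Gamma (1 + σ) * ‖(Complex.Gamma (1 + w))⁻¹‖ *
        (x ^ (m + σ) * (Real.Gamma (1 + σ + m))⁻¹) := by ring
    _ ≤ _ := mul_le_mul_of_nonneg_left h2 hQ

theorem exists_norm_inv_Gamma_le (z₀ : ℂ) (N : ℕ) :
    ∃ C, 0 ≤ C ∧ ∀ n < N, ∀ z ∈ Metric.ball z₀ 1, ‖(Complex.Gamma (1 + n + z))⁻¹‖ ≤ C := by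
  have h : ∀ n : ℕ, ∃ C, ∀ z ∈ Metric.closedBall z₀ 1, ‖(Complex.Gamma (1 + n + z))⁻¹‖ ≤ C := by
    intro n
    refine (isCompact_closedBall z₀ 1).exists_bound_of_continuousOn ?_
    exact (Complex.differentiable_one_div_Gamma.continuous.comp
      (f := fun z : ℂ ↦ 1 + n + z) (by fun_prop)).continuousOn
  choose C hC using h
  have hC0 : ∀ n, 0 ≤ C n := fun n ↦
    (norm_nonneg _).trans (hC n z₀ (Metric.mem_closedBall_self zero_le_one))
  refine ⟨∑ n ∈ Finset.range N, C n, Finset.sum_nonneg fun n _ ↦ hC0 n, fun n hn z hz ↦ ?_⟩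
  exact (hC n z (Metric.ball_subset_closedBall hz)).trans
    (Finset.single_le_sum (fun n _ ↦ hC0 n) (Finset.mem_range.2 hn))

theorem exists_Gamma_re_mul_norm_inv_Gamma_le {z₀ : ℂ} (h : 1 < z₀.re) :
    ∃ C, 0 ≤ C ∧ ∀ z ∈ Metric.ball z₀ 1,
      Real.Gamma (1 + z.re) * ‖(Complex.Gamma (1 + z))⁻¹‖ ≤ C := by
  have hc : ContinuousOn (fun z : ℂ ↦ Real.Gamma (1 + z.re) * ‖(Complex.Gamma (1 + z))⁻¹‖)
      (Metric.closedBall z₀ 1) := by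
    refine ContinuousOn.mul (fun z hz ↦ ContinuousAt.continuousWithinAt ?_)
      (Continuous.continuousOn (Continuous.norm
        (Complex.differentiable_one_div_Gamma.continuous.comp
          (f := fun z : ℂ ↦ 1 + z) (by fun_prop))))
    have hre : 0 < z.re := by
      have := (Complex.abs_re_le_norm (z - z₀)).trans (by simpa [dist_eq_norm] using hz)
      rw [Complex.sub_re] at this
      linarith [(abs_le.1 this).1]
    refine ContinuousAt.comp (g := Real.Gamma) (f := fun z : ℂ ↦ 1 + z.re)
      (Real.differentiableAt_Gamma fun m ↦ ?_).continuousAt (by fun_prop)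
    have : (0 : ℝ) ≤ m := m.cast_nonneg
    linarith
  obtain ⟨C, hC⟩ := (isCompact_closedBall z₀ 1).exists_bound_of_continuousOn hc
  have hC' : ∀ z ∈ Metric.closedBall z₀ 1,
      Real.Gamma (1 + z.re) * ‖(Complex.Gamma (1 + z))⁻¹‖ ≤ C :=
    fun z hz ↦ (le_abs_self _).trans (hC z hz)
  refine ⟨C, (norm_nonneg _).trans (hC z₀ (Metric.mem_closedBall_self zero_le_one)), fun z hz ↦
    hC' z (Metric.ball_subset_closedBall hz)⟩

theorem abs_re_sub_lt {z z₀ : ℂ} (hz : z ∈ Metric.ball z₀ 1) : |z.re - z₀.re| < 1 := by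
  rw [← Complex.sub_re]
  exact (Complex.abs_re_le_norm _).trans_lt (by simpa [dist_eq_norm] using hz)

/-- Locally uniformly in `z`, the terms `x^{n+z} / Γ(1+n+z)` have majorants whose sum over `n` is
`O(eˣ)`; no logarithmic factor is lost. -/
theorem exists_mlTerm_majorant (z₀ : ℂ) : ∃ (M : ℕ → ℝ → ℝ) (C : ℝ),
    (∀ n x, 0 < x → 0 ≤ M n x) ∧
    (∀ n x, 0 < x → ∀ z ∈ Metric.ball z₀ 1, ‖mlTerm n x z‖ ≤ M n x) ∧
    (∀ x, 0 < x → Summable fun n ↦ M n x) ∧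
    (∀ᶠ x in atTop, ∑' n, M n x ≤ C * Real.exp x) ∧
    (∀ n, IsExpNegligible (M n)) := by
  obtain ⟨N, hN⟩ := exists_nat_gt (2 - z₀.re)
  obtain ⟨K, hK⟩ := exists_nat_gt (N + z₀.re + 1)
  obtain ⟨C₁, hC₁, h₁⟩ := exists_norm_inv_Gamma_le z₀ N
  have hN1 : 1 < (N + z₀ : ℂ).re := by simp; linarith
  obtain ⟨C₂, hC₂, h₂⟩ := exists_Gamma_re_mul_norm_inv_Gamma_le hN1
  -- `P` bounds the terms with `n < N`, where the real part of `n + z` may be too small for the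
  -- bound `Q` of the other terms
  let P : ℝ → ℝ := fun x ↦ C₁ * (x ^ (N + z₀.re + 1) + x ^ (z₀.re - 1))
  let Q : ℕ → ℝ → ℝ := fun m x ↦
    C₂ * (x ^ m / m.factorial + (K + 1) ^ K * (x ^ (m + K) / (m + K).factorial))
  let M : ℕ → ℝ → ℝ := fun n x ↦ if n < N then P x else Q (n - N) x
  have hMN : ∀ m x, M (m + N) x = Q m x := fun m x ↦ by simp [M]
  have hsQ : ∀ x, HasSum (fun m : ℕ ↦ x ^ m / (m.factorial : ℝ)) (Real.exp x) := fun x ↦ by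
    have := NormedSpace.expSeries_div_hasSum_exp x
    rwa [← Real.exp_eq_exp_ℝ] at this
  have hsK : ∀ x : ℝ, Summable fun m ↦ x ^ (m + K) / ((m + K).factorial : ℝ) := fun x ↦
    (summable_nat_add_iff (f := fun m ↦ x ^ m / (m.factorial : ℝ)) K).2 (hsQ x).summable
  have hQs : ∀ x, Summable fun m ↦ Q m x := fun x ↦
    ((hsQ x).summable.add ((hsK x).mul_left _)).mul_left _
  have hMs : ∀ x, Summable fun n ↦ M n x := fun x ↦ by
    rw [← summable_nat_add_iff N]
    simpa only [hMN] using hQs x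
  have hP : IsExpNegligible P := ((isExpNegligible_rpow _).add (isExpNegligible_rpow _)).const_mul _
  have hQn : ∀ m, IsExpNegligible (Q m) := fun m ↦ by
    have e : Q m = fun x ↦ C₂ * ((m.factorial : ℝ)⁻¹ * x ^ m +
        ((K + 1) ^ K * ((m + K).factorial : ℝ)⁻¹) * x ^ (m + K)) := by
      funext x
      simp only [Q]
      ring
    rw [e]
    exact (((isExpNegligible_pow _).const_mul _).add ((isExpNegligible_pow _).const_mul
      _)).const_mul _
  refine ⟨M, 1 + C₂ * (1 + (K + 1) ^ K), ?_, ?_, fun x _ ↦ hMs x, ?_, ?_⟩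
  · intro n x hx
    simp only [M]
    split_ifs <;> positivity
  · intro n x hx z hz
    have hre := abs_lt.1 (abs_re_sub_lt hz)
    simp only [M]
    split_ifs with hn
    · rw [norm_mlTerm hx, mul_comm]
      refine mul_le_mul (h₁ n hn z hz) ?_ (by positivity) hC₁
      have hn' : (n : ℝ) ≤ N := by exact_mod_cast hn.le
      have hn0 : (0 : ℝ) ≤ n := n.cast_nonneg
      rcases le_total 1 x with h | h
      · exact (Real.rpow_le_rpow_of_exponent_le h (by linarith)).trans
          (le_add_of_nonneg_right (by positivity))
      · exact (Real.rpow_le_rpow_of_exponent_ge hx h (by linarith)).trans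
          (le_add_of_nonneg_left (by positivity))
    · obtain ⟨m, rfl⟩ := Nat.exists_eq_add_of_le' (not_lt.1 hn)
      rw [mlTerm_add_nat, Nat.add_sub_cancel]
      have hz' : (N + z : ℂ) ∈ Metric.ball (N + z₀ : ℂ) 1 := by simpa [dist_eq_norm] using hz
      refine (norm_mlTerm_le (K := K) (by simp; linarith) (by simp; linarith) hx m).trans ?_
      exact mul_le_mul_of_nonneg_right (h₂ _ hz') (by positivity)
  · have hsum := (IsExpNegligible.sum (s := Finset.range N) fun _ _ ↦ hP) 0
    filter_upwards [hsum.eventually (gt_mem_nhds one_pos), eventually_gt_atTop 0] with x hx hx0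
    rw [← (hMs x).sum_add_tsum_nat_add N]
    simp only [hMN]
    have h3 : ∑ n ∈ Finset.range N, M n x ≤ Real.exp x := by
      rw [Finset.sum_congr rfl fun n hn ↦ if_pos (Finset.mem_range.1 hn)]
      rw [pow_zero, mul_one, Real.exp_neg, ← div_eq_mul_inv, div_lt_one (Real.exp_pos x)] at hx
      exact hx.le
    have h4 : ∑' m, x ^ (m + K) / ((m + K).factorial : ℝ) ≤ Real.exp x := by
      rw [← (hsQ x).tsum_eq, ← (hsQ x).summable.sum_add_tsum_nat_add K]
      exact le_add_of_nonneg_left (Finset.sum_nonneg fun _ _ ↦ by positivity)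
    have h5 : ∑' m, Q m x ≤ C₂ * (Real.exp x + (K + 1) ^ K * Real.exp x) := by
      simp only [Q]
      rw [tsum_mul_left, (hsQ x).summable.tsum_add ((hsK x).mul_left _), tsum_mul_left,
        (hsQ x).tsum_eq]
      gcongr
    linarith
  · intro n
    simp only [M]
    by_cases hn : n < N
    · simpa only [hn, if_true] using hP
    · simpa only [hn, if_false] using hQn (n - N)

end GammaBounds

/-! ### The scalar series as a Riemann-Liouville integral -/

section MittagLefflerSum

open MeasureTheory

theorem mlTerm_eq_cpow (n : ℕ) {x : ℝ} (hx : 0 < x) (z : ℂ) :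
    mlTerm n x z = (x : ℂ) ^ (n + z) * (Complex.Gamma (1 + n + z))⁻¹ := by
  rw [mlTerm, Complex.cpow_def_of_ne_zero (Complex.ofReal_ne_zero.2 hx.ne'),
    Complex.ofReal_log hx.le]

/-- The Beta integral, in the form of a Riemann-Liouville integral of a power. -/
theorem integral_cpow_mul_sub_pow {w : ℂ} (hw : 0 < w.re) {x : ℝ} (hx : 0 < x) (n : ℕ) :
    ∫ t in (0 : ℝ)..x, (t : ℂ) ^ (w - 1) * ((x - t : ℂ) ^ n / n.factorial) =
      Complex.Gamma w * mlTerm n x w := by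
  have h1 := Complex.betaIntegral_scaled w (n + 1) hx
  have h2 := Complex.Gamma_mul_Gamma_eq_betaIntegral (s := w) (t := n + 1) hw
    (by simp; positivity)
  have h3 : Complex.Gamma (w + (n + 1)) ≠ 0 := Complex.Gamma_ne_zero_of_re_pos (by
    simp; positivity)
  have h4 : (n.factorial : ℂ) ≠ 0 := Nat.cast_ne_zero.2 n.factorial_ne_zero
  rw [Complex.Gamma_nat_eq_factorial] at h2
  simp only [add_sub_cancel_right, Complex.cpow_natCast] at h1
  simp only [← mul_div_assoc]
  rw [intervalIntegral.integral_div, h1, mlTerm_eq_cpow n hx,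
    show w + (n + 1) - 1 = (n + w : ℂ) by ring, show (1 + n + w : ℂ) = w + (n + 1) by ring]
  field_simp
  linear_combination (-(x : ℂ) ^ (n + w)) * h2

/-- The series `∑ₙ ξⁿ x^{n+w} / Γ(1+n+w)` solves `y' = ξ y + x^{w-1} / Γ(w)`, `y(0) = 0`;
the solution formula is obtained by expanding the exponential under the integral. -/
theorem hasSum_mlTerm_integral {w : ℂ} (hw : 1 < w.re) {x : ℝ} (hx : 0 < x) (ξ : ℂ) :
    HasSum (fun n ↦ ξ ^ n * mlTerm n x w) ((Complex.Gamma w)⁻¹ *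
      ∫ t in (0 : ℝ)..x, (t : ℂ) ^ (w - 1) * Complex.exp (ξ * (x - t))) := by
  have hG : Complex.Gamma w ≠ 0 := Complex.Gamma_ne_zero_of_re_pos (by linarith)
  have hcont : Continuous fun t : ℝ ↦ (t : ℂ) ^ (w - 1) :=
    Complex.continuous_ofReal_cpow_const (by simp; linarith)
  have h : HasSum (fun n ↦ ∫ t in (0 : ℝ)..x, (t : ℂ) ^ (w - 1) *
        ((ξ * (x - t : ℂ)) ^ n / n.factorial))
      (∫ t in (0 : ℝ)..x, (t : ℂ) ^ (w - 1) * Complex.exp (ξ * (x - t))) := by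
    refine intervalIntegral.hasSum_integral_of_dominated_convergence
      (fun n t ↦ ‖(t : ℂ) ^ (w - 1)‖ * ((‖ξ‖ * x) ^ n / n.factorial)) ?_ ?_ ?_ ?_ ?_
    · intro n
      exact Continuous.aestronglyMeasurable (by fun_prop)
    · intro n
      refine .of_forall fun t ht ↦ ?_
      rw [Set.uIoc_of_le hx.le] at ht
      have e : ‖(x - t : ℂ)‖ ≤ x := by
        rw [← Complex.ofReal_sub, Complex.norm_real, Real.norm_eq_abs,
          abs_of_nonneg (by linarith [ht.2])]
        linarith [ht.1]
      rw [norm_mul, norm_div, norm_pow, norm_mul, Complex.norm_natCast]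
      gcongr
    · refine .of_forall fun t _ ↦ (Real.summable_pow_div_factorial _).mul_left _
    · simp_rw [tsum_mul_left]
      exact Continuous.intervalIntegrable (by fun_prop) _ _
    · refine .of_forall fun t _ ↦ HasSum.mul_left _ ?_
      rw [Complex.exp_eq_exp_ℂ]
      exact NormedSpace.expSeries_div_hasSum_exp _
  refine (h.mul_left (Complex.Gamma w)⁻¹).congr_fun ?_
  intro n
  have e : ∀ t : ℝ, (t : ℂ) ^ (w - 1) * ((ξ * (x - t : ℂ)) ^ n / n.factorial) =
      ξ ^ n * ((t : ℂ) ^ (w - 1) * ((x - t : ℂ) ^ n / n.factorial)) := fun t ↦ by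
    rw [mul_pow]; ring
  simp_rw [e]
  rw [intervalIntegral.integral_const_mul, integral_cpow_mul_sub_pow (by linarith) hx]
  field_simp

theorem norm_integral_cpow_mul_exp_le {w : ℂ} (hw : 1 < w.re) {x : ℝ} (hx : 0 < x) {ξ : ℂ} {c : ℝ}
    (hc : 0 ≤ c) (hξ : ξ.re ≤ c) :
    ‖∫ t in (0 : ℝ)..x, (t : ℂ) ^ (w - 1) * Complex.exp (ξ * (x - t))‖ ≤
      Real.exp (c * x) * x ^ w.re := by
  have h := intervalIntegral.norm_integral_le_of_norm_le_const (a := 0) (b := x)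
    (f := fun t : ℝ ↦ (t : ℂ) ^ (w - 1) * Complex.exp (ξ * (x - t)))
    (C := x ^ (w.re - 1) * Real.exp (c * x)) (fun t ht ↦ by
      rw [Set.uIoc_of_le hx.le] at ht
      rw [norm_mul, Complex.norm_cpow_eq_rpow_re_of_pos ht.1, Complex.norm_exp,
        ← Complex.ofReal_sub, Complex.re_mul_ofReal, Complex.sub_re, Complex.one_re]
      have h1 : ξ.re * (x - t) ≤ c * x :=
        mul_le_mul hξ (by linarith [ht.1]) (by linarith [ht.2]) hc
      have h2 : t ^ (w.re - 1) ≤ x ^ (w.re - 1) :=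
        Real.rpow_le_rpow ht.1.le ht.2 (by linarith)
      gcongr)
  refine h.trans (le_of_eq ?_)
  rw [sub_zero, abs_of_pos hx, Real.rpow_sub_one hx.ne']
  field_simp

theorem norm_inv_Gamma_mul_integral_sub_exp_le {w : ℂ} (hw : 1 < w.re) {x : ℝ} (hx : 0 < x) :
    ‖(Complex.Gamma w)⁻¹ * (∫ t in (0 : ℝ)..x, (t : ℂ) ^ (w - 1) * Complex.exp (1 * (x - t))) -
      Real.exp x‖ ≤
        ‖(Complex.Gamma w)⁻¹‖ * (2 ^ w.re * Real.Gamma w.re) * Real.exp (1 / 2 * x) := by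
  have hw0 : 0 < w.re := by linarith
  have hG : Complex.Gamma w ≠ 0 := Complex.Gamma_ne_zero_of_re_pos hw0
  let f : ℝ → ℂ := fun t ↦ Complex.exp (-t) * (t : ℂ) ^ (w - 1)
  have hf : IntegrableOn f (Set.Ioi 0) := by
    simpa [f] using Complex.GammaIntegral_convergent hw0
  have hGam : ∫ t in Set.Ioi 0, f t = Complex.Gamma w := by
    rw [Complex.Gamma_eq_integral hw0, Complex.GammaIntegral]
    simp [f]
  have hsplit : ∫ t in Set.Ioi 0, f t = (∫ t in (0 : ℝ)..x, f t) + ∫ t in Set.Ioi x, f t := by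
    rw [intervalIntegral.integral_of_le hx.le, ← Set.Ioc_union_Ioi_eq_Ioi hx.le]
    exact setIntegral_union (Set.Ioc_disjoint_Ioi le_rfl) measurableSet_Ioi
      (hf.mono_set Set.Ioc_subset_Ioi_self) (hf.mono_set (Set.Ioi_subset_Ioi hx.le))
  have he : ∫ t in (0 : ℝ)..x, (t : ℂ) ^ (w - 1) * Complex.exp (1 * (x - t)) =
      Complex.exp x * ∫ t in (0 : ℝ)..x, f t := by
    rw [← intervalIntegral.integral_const_mul]
    congr 1
    funext t
    simp only [f]
    rw [one_mul, Complex.exp_sub, Complex.exp_neg]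
    ring
  have hkey : (Complex.Gamma w)⁻¹ * (∫ t in (0 : ℝ)..x, (t : ℂ) ^ (w - 1) *
      Complex.exp (1 * (x - t))) - Real.exp x =
      -((Complex.Gamma w)⁻¹ * Complex.exp x * ∫ t in Set.Ioi x, f t) := by
    rw [he, eq_sub_of_add_eq hsplit.symm, hGam, Complex.ofReal_exp]
    field_simp
    ring
  have hint : IntegrableOn (fun t : ℝ ↦ t ^ (w.re - 1) * Real.exp (-(1 / 2 * t))) (Set.Ioi 0) := by
    have := integrableOn_rpow_mul_exp_neg_mul_rpow (s := w.re - 1) (p := 1) (b := 1 / 2)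
      (by linarith) one_pos (by norm_num)
    simpa using this
  -- the tail integral is `O(e^{-x/2})`, as half of the exponential decay suffices for convergence
  have hval : ∫ t in Set.Ioi (0 : ℝ), t ^ (w.re - 1) * Real.exp (-(1 / 2 * t)) =
      2 ^ w.re * Real.Gamma w.re := by
    rw [Real.integral_rpow_mul_exp_neg_mul_Ioi hw0 (by norm_num)]
    norm_num
  have htail : ‖∫ t in Set.Ioi x, f t‖ ≤
      Real.exp (-(1 / 2 * x)) * (2 ^ w.re * Real.Gamma w.re) := by
    have hint' := (hint.mono_set (Set.Ioi_subset_Ioi hx.le)).const_mul (Real.exp (-(1 / 2 * x)))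
    refine (norm_integral_le_of_norm_le hint' ?_).trans ?_
    · refine (ae_restrict_mem measurableSet_Ioi).mono fun t ht ↦ ?_
      have ht0 : 0 < t := hx.trans ht
      have htx : x < t := ht
      simp only [f]
      rw [norm_mul, Complex.norm_cpow_eq_rpow_re_of_pos ht0, Complex.norm_exp, Complex.sub_re,
        Complex.one_re, Complex.neg_re, Complex.ofReal_re, mul_comm, mul_left_comm, ← Real.exp_add]
      gcongr
      linarith
    · rw [integral_const_mul, ← hval]
      refine mul_le_mul_of_nonneg_left ?_ (Real.exp_pos _).le
      refine setIntegral_mono_set hint ?_ (LE.le.eventuallyLE (Set.Ioi_subset_Ioi hx.le))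
      refine (ae_restrict_mem measurableSet_Ioi).mono fun t ht ↦ ?_
      have ht0 : (0 : ℝ) < t := ht
      simp only [Pi.zero_apply]
      positivity
  rw [hkey, norm_neg, norm_mul, norm_mul, Complex.norm_exp, Complex.ofReal_re]
  calc ‖(Complex.Gamma w)⁻¹‖ * Real.exp x * ‖∫ t in Set.Ioi x, f t‖
      ≤ ‖(Complex.Gamma w)⁻¹‖ * Real.exp x *
        (Real.exp (-(1 / 2 * x)) * (2 ^ w.re * Real.Gamma w.re)) := by gcongr
    _ = ‖(Complex.Gamma w)⁻¹‖ * (2 ^ w.re * Real.Gamma w.re) *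
        (Real.exp x * Real.exp (-(1 / 2 * x))) := by ring
    _ = _ := by
      rw [← Real.exp_add]
      congr 2
      ring

end MittagLefflerSum

/-! ### Asymptotics of the scalar series, uniformly in the exponent -/

section MittagLefflerAsymptotics

theorem exists_bound_norm_inv_Gamma {z₀ : ℂ} (h : 1 < z₀.re) :
    ∃ C, 0 ≤ C ∧ (∀ z ∈ Metric.ball z₀ 1, ‖(Complex.Gamma z)⁻¹‖ ≤ C) ∧
      ∀ z ∈ Metric.ball z₀ 1,
        ‖(Complex.Gamma z)⁻¹‖ * (2 ^ z.re * Real.Gamma z.re) ≤ C := by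
  have hc₁ : Continuous fun z : ℂ ↦ ‖(Complex.Gamma z)⁻¹‖ :=
    Complex.differentiable_one_div_Gamma.continuous.norm
  have hc₂ : ContinuousOn (fun z : ℂ ↦ ‖(Complex.Gamma z)⁻¹‖ * (2 ^ z.re * Real.Gamma z.re))
      (Metric.closedBall z₀ 1) := by
    refine hc₁.continuousOn.mul (ContinuousOn.mul (Continuous.continuousOn ?_) fun z hz ↦
      ContinuousAt.continuousWithinAt ?_)
    · exact (Real.continuous_const_rpow two_ne_zero).comp Complex.continuous_re
    · have hre : 0 < z.re := by
        have := (Complex.abs_re_le_norm (z - z₀)).trans (by simpa [dist_eq_norm] using hz)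
        rw [Complex.sub_re] at this
        linarith [(abs_le.1 this).1]
      refine ContinuousAt.comp (g := Real.Gamma) (f := Complex.re)
        (Real.differentiableAt_Gamma fun m ↦ ?_).continuousAt (by fun_prop)
      have : (0 : ℝ) ≤ m := m.cast_nonneg
      linarith
  obtain ⟨C₁, h₁⟩ := (isCompact_closedBall z₀ 1).exists_bound_of_continuousOn hc₁.continuousOn
  obtain ⟨C₂, h₂⟩ := (isCompact_closedBall z₀ 1).exists_bound_of_continuousOn hc₂
  have hsub : Metric.ball z₀ 1 ⊆ Metric.closedBall z₀ 1 := Metric.ball_subset_closedBall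
  have hz₀ : z₀ ∈ Metric.closedBall z₀ 1 := Metric.mem_closedBall_self zero_le_one
  refine ⟨max C₁ C₂, le_max_of_le_left ((norm_nonneg _).trans (h₁ z₀ hz₀)), fun z hz ↦ ?_,
    fun z hz ↦ ?_⟩
  · exact (le_abs_self _).trans ((h₁ z (hsub hz)).trans (le_max_left _ _))
  · exact (le_abs_self _).trans ((h₂ z (hsub hz)).trans (le_max_right _ _))

theorem re_lt_one_of_norm_eq_one {ξ : ℂ} (hξ : ‖ξ‖ = 1) (h1 : ξ ≠ 1) : ξ.re < 1 := by
  refine lt_of_le_of_ne ((Complex.re_le_norm ξ).trans hξ.le) fun h ↦ h1 ?_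
  have h2 := Complex.sq_norm ξ
  rw [hξ, Complex.normSq_apply, h] at h2
  have h3 : ξ.im = 0 := by nlinarith
  exact Complex.ext h h3

/-- On the unit circle, the series `∑ₙ ξⁿ x^{n+z} / Γ(1+n+z)` is exponentially small compared with
`eˣ`, except for `ξ = 1`, when it is `eˣ` up to such an error. -/
theorem exists_norm_tsum_mlTerm_sub_le_of_two_lt_re {ξ : ℂ} (hξ : ‖ξ‖ = 1) {z₀ : ℂ}
    (hz₀ : 2 < z₀.re) : ∃ E : ℝ → ℝ, IsExpNegligible E ∧ ∀ᶠ x in atTop,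
      ∀ z ∈ Metric.ball z₀ 1,
        ‖(∑' n, ξ ^ n * mlTerm n x z) - if ξ = 1 then (Real.exp x : ℂ) else 0‖ ≤ E x := by
  obtain ⟨C, hC, hC₁, hC₂⟩ := exists_bound_norm_inv_Gamma (z₀ := z₀) (by linarith)
  have hre : ∀ z ∈ Metric.ball z₀ 1, 1 < z.re := fun z hz ↦ by
    linarith [(abs_lt.1 (abs_re_sub_lt hz)).1]
  by_cases h1 : ξ = 1
  · refine ⟨fun x ↦ C * (Real.exp (1 / 2 * x) * x ^ (0 : ℝ)),
      (isExpNegligible_exp_mul_rpow (by norm_num) 0).const_mul _, ?_⟩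
    filter_upwards [eventually_gt_atTop 0] with x hx z hz
    rw [(hasSum_mlTerm_integral (hre z hz) hx ξ).tsum_eq, if_pos h1, h1, Real.rpow_zero, mul_one]
    refine (norm_inv_Gamma_mul_integral_sub_exp_le (hre z hz) hx).trans ?_
    exact mul_le_mul_of_nonneg_right (hC₂ z hz) (Real.exp_pos _).le
  · refine ⟨fun x ↦ C * (Real.exp (max ξ.re 0 * x) * x ^ (z₀.re + 1)),
      (isExpNegligible_exp_mul_rpow
        (max_lt (re_lt_one_of_norm_eq_one hξ h1) one_pos) _).const_mul _, ?_⟩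
    filter_upwards [eventually_ge_atTop 1] with x hx z hz
    have hx0 : 0 < x := by linarith
    rw [(hasSum_mlTerm_integral (hre z hz) hx0 ξ).tsum_eq, if_neg h1, sub_zero, norm_mul]
    refine mul_le_mul (hC₁ z hz) ((norm_integral_cpow_mul_exp_le (hre z hz) hx0
      (le_max_right ξ.re 0) (le_max_left _ _)).trans ?_) (norm_nonneg _) hC
    have := (abs_lt.1 (abs_re_sub_lt hz)).2
    gcongr
    linarith

theorem exists_norm_tsum_mlTerm_sub_le {ξ : ℂ} (hξ : ‖ξ‖ = 1) (z₀ : ℂ) :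
    ∃ E : ℝ → ℝ, IsExpNegligible E ∧ ∀ᶠ x in atTop, ∀ z ∈ Metric.ball z₀ 1,
      ‖(∑' n, ξ ^ n * mlTerm n x z) - if ξ = 1 then (Real.exp x : ℂ) else 0‖ ≤ E x := by
  obtain ⟨N, hN⟩ := exists_nat_gt (2 - z₀.re)
  obtain ⟨E, hE, hE'⟩ := exists_norm_tsum_mlTerm_sub_le_of_two_lt_re hξ (z₀ := N + z₀)
    (by simp; linarith)
  obtain ⟨M, C, -, hM, hMs, -, hM0⟩ := exists_mlTerm_majorant z₀
  refine ⟨fun x ↦ (∑ n ∈ Finset.range N, M n x) + E x,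
    (IsExpNegligible.sum fun n _ ↦ hM0 n).add hE, ?_⟩
  filter_upwards [hE', eventually_gt_atTop 0] with x hx hx0 z hz
  have hle : ∀ n, ‖ξ ^ n * mlTerm n x z‖ ≤ M n x := fun n ↦ by
    rw [norm_mul, norm_pow, hξ, one_pow, one_mul]
    exact hM n x hx0 z hz
  have hs : Summable fun n ↦ ξ ^ n * mlTerm n x z := (hMs x hx0).of_norm_bounded hle
  have hz' : (N + z : ℂ) ∈ Metric.ball (N + z₀ : ℂ) 1 := by simpa [dist_eq_norm] using hz
  have hshift : ∀ n, ξ ^ (n + N) * mlTerm (n + N) x z =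
      ξ ^ N * (ξ ^ n * mlTerm n x (N + z)) := fun n ↦ by
    rw [mlTerm_add_nat, pow_add]; ring
  have hif : (if ξ = 1 then (Real.exp x : ℂ) else 0) =
      ξ ^ N * if ξ = 1 then (Real.exp x : ℂ) else 0 := by
    split_ifs with h <;> simp [h]
  rw [← hs.sum_add_tsum_nat_add N, add_sub_assoc, hif]
  simp only [hshift]
  rw [tsum_mul_left, ← mul_sub]
  refine (norm_add_le _ _).trans (add_le_add ((norm_sum_le _ _).trans
    (Finset.sum_le_sum fun n _ ↦ hle n)) ?_)
  rw [norm_mul, norm_pow, hξ, one_pow, one_mul]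
  exact hx _ hz'

theorem sum_mul_pow_pow_eq {r : ℕ} {η : ℂ} (hη : IsPrimitiveRoot η r) (ξ : ℂ) (n : ℕ) :
    ∑ j ∈ Finset.range r, (ξ * η ^ j) ^ n = if r ∣ n then r * ξ ^ n else 0 := by
  have h : ∀ j, (ξ * η ^ j) ^ n = ξ ^ n * (η ^ n) ^ j := fun j ↦ by
    rw [mul_pow, ← pow_mul, ← pow_mul, mul_comm j n]
  simp only [h, ← Finset.mul_sum]
  split_ifs with hn
  · rw [(hη.pow_eq_one_iff_dvd n).2 hn]
    simp [mul_comm]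
  · have hne : η ^ n ≠ 1 := fun h ↦ hn ((hη.pow_eq_one_iff_dvd n).1 h)
    rw [geom_sum_eq hne, ← pow_mul, mul_comm n r, pow_mul, hη.pow_eq_one, one_pow, sub_self,
      zero_div, mul_zero]

theorem sum_ite_mul_pow_eq_one {r : ℕ} (hr : 0 < r) {η : ℂ} (hη : IsPrimitiveRoot η r) (ξ c : ℂ) :
    (∑ j ∈ Finset.range r, if ξ * η ^ j = 1 then c else 0) = if ξ ^ r = 1 then c else 0 := by
  have : NeZero r := ⟨hr.ne'⟩
  split_ifs with h
  · have hξ0 : ξ ≠ 0 := fun h0 ↦ by simp [h0, hr.ne'] at h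
    obtain ⟨i, hi, hi'⟩ := hη.eq_pow_of_pow_eq_one (ξ := ξ⁻¹) (by rw [inv_pow, h, inv_one])
    rw [Finset.sum_eq_single_of_mem i (Finset.mem_range.2 hi), if_pos]
    · rw [hi', mul_inv_cancel₀ hξ0]
    · intro j hj hji
      refine if_neg fun h1 ↦ hji (hη.pow_inj (Finset.mem_range.1 hj) hi ?_)
      rw [hi', eq_inv_of_mul_eq_one_right h1]
  · refine Finset.sum_eq_zero fun j _ ↦ if_neg fun h1 ↦ h ?_
    have := congrArg (· ^ r) h1
    simp only [mul_pow, one_pow, ← pow_mul] at this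
    rwa [mul_comm j r, pow_mul, hη.pow_eq_one, one_pow, mul_one] at this

/-- The sum over the multiples of `r` is the average, over the `r`-th roots of unity, of the full
sums. -/
theorem exists_norm_tsum_mlTerm_multiples_sub_le {r : ℕ} (hr : 0 < r) {ξ : ℂ} (hξ : ‖ξ‖ = 1)
    (z₀ : ℂ) : ∃ E : ℝ → ℝ, IsExpNegligible E ∧ ∀ᶠ x in atTop, ∀ z ∈ Metric.ball z₀ 1,
      ‖(∑' m, ξ ^ (r * m) * mlTerm (r * m) x z) -
        if ξ ^ r = 1 then (1 / r * Real.exp x : ℂ) else 0‖ ≤ E x := by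
  obtain ⟨M, C, -, hM, hMs, -, -⟩ := exists_mlTerm_majorant z₀
  set η := Complex.exp (2 * Real.pi * Complex.I / r)
  have hη : IsPrimitiveRoot η r := Complex.isPrimitiveRoot_exp r hr.ne'
  have hn : ∀ j : ℕ, ‖ξ * η ^ j‖ = 1 := fun j ↦ by
    rw [norm_mul, norm_pow, hη.norm'_eq_one hr.ne', one_pow, hξ, one_mul]
  choose E hE hE' using fun j : ℕ ↦ exists_norm_tsum_mlTerm_sub_le (hn j) z₀
  have hr' : (r : ℂ) ≠ 0 := Nat.cast_ne_zero.2 hr.ne'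
  refine ⟨fun x ↦ (1 / r : ℝ) * ∑ j ∈ Finset.range r, E j x,
    (IsExpNegligible.sum fun j _ ↦ hE j).const_mul _, ?_⟩
  have hall : ∀ᶠ x in atTop, ∀ j ∈ Finset.range r, ∀ z ∈ Metric.ball z₀ 1,
      ‖(∑' n, (ξ * η ^ j) ^ n * mlTerm n x z) -
        if ξ * η ^ j = 1 then (Real.exp x : ℂ) else 0‖ ≤ E j x :=
    (Finset.eventually_all _).2 fun j _ ↦ hE' j
  filter_upwards [hall, eventually_gt_atTop 0] with x hx hx0 z hz
  have hs : ∀ j, Summable fun n ↦ (ξ * η ^ j) ^ n * mlTerm n x z := fun j ↦ by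
    refine (hMs x hx0).of_norm_bounded fun n ↦ ?_
    rw [norm_mul, norm_pow, hn, one_pow, one_mul]
    exact hM n x hx0 z hz
  have hsum : ∑' m, ξ ^ (r * m) * mlTerm (r * m) x z =
      1 / r * ∑ j ∈ Finset.range r, ∑' n, (ξ * η ^ j) ^ n * mlTerm n x z := by
    have h1 := (hasSum_sum fun j (_ : j ∈ Finset.range r) ↦ (hs j).hasSum).mul_left (1 / r : ℂ)
    rw [← h1.tsum_eq]
    have h2 : ∀ n, 1 / (r : ℂ) * ∑ j ∈ Finset.range r, (ξ * η ^ j) ^ n * mlTerm n x z =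
        if r ∣ n then ξ ^ n * mlTerm n x z else 0 := fun n ↦ by
      rw [← Finset.sum_mul, sum_mul_pow_pow_eq hη]
      split_ifs
      · field_simp
      · simp
    simp only [h2]
    have hinj : Function.Injective fun m : ℕ ↦ r * m := fun a b h ↦ Nat.eq_of_mul_eq_mul_left hr h
    rw [← hinj.tsum_eq (f := fun n ↦ if r ∣ n then ξ ^ n * mlTerm n x z else 0)]
    · simp
    · intro n hn
      have : r ∣ n := by
        by_contra h
        simp [h] at hn
      obtain ⟨m, rfl⟩ := this
      exact ⟨m, rfl⟩
  have hif : (if ξ ^ r = 1 then (1 / r * Real.exp x : ℂ) else 0) =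
      1 / r * ∑ j ∈ Finset.range r, if ξ * η ^ j = 1 then (Real.exp x : ℂ) else 0 := by
    rw [sum_ite_mul_pow_eq_one hr hη]
    split_ifs <;> simp
  rw [hsum, hif, ← mul_sub, ← Finset.sum_sub_distrib, norm_mul, norm_div, norm_one,
    Complex.norm_natCast]
  refine mul_le_mul_of_nonneg_left ((norm_sum_le _ _).trans (Finset.sum_le_sum fun j hj ↦ ?_))
    (by positivity)
  exact hx j hj z hz

end MittagLefflerAsymptotics

/-! ### Asymptotic expansions of sequences in powers of `1 / m` -/

section Expansion

variable {H : Type*} [Ring H] [Algebra ℂ H] [TopologicalSpace H]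

/-- The sequence `ρ` has an asymptotic expansion to order `m^{-L}` in powers of `1 / m`, with
leading coefficient `A`. The higher coefficients are obtained successively, as limits of
`m (ρ m - A)` and so on. -/
def HasInvExpansion : ℕ → (ℕ → H) → H → Prop
  | 0, ρ, A => Tendsto ρ atTop (𝓝 A)
  | L + 1, ρ, A => ∃ A₁, HasInvExpansion L (fun m ↦ (m : ℂ) • (ρ m - A)) A₁

theorem HasInvExpansion.congr {L : ℕ} {ρ σ : ℕ → H} {A : H} (h : HasInvExpansion L ρ A)
    (he : ρ =ᶠ[atTop] σ) : HasInvExpansion L σ A := by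
  induction L generalizing ρ σ A with
  | zero => exact Tendsto.congr' he h
  | succ L ih =>
    obtain ⟨A₁, h⟩ := h
    exact ⟨A₁, ih h (he.mono fun m hm ↦ by simp only [hm])⟩

theorem hasInvExpansion_const (L : ℕ) (A : H) : HasInvExpansion L (fun _ ↦ A) A := by
  induction L generalizing A with
  | zero => exact tendsto_const_nhds
  | succ L ih => exact ⟨0, (ih 0).congr (.of_forall fun m ↦ by simp)⟩

theorem tendsto_inv_natCast_smul [ContinuousSMul ℂ H] {ρ : ℕ → H} {A : H}
    (h : Tendsto ρ atTop (𝓝 A)) : Tendsto (fun m : ℕ ↦ (m : ℂ)⁻¹ • ρ m) atTop (𝓝 0) := by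
  rw [← zero_smul ℂ A]
  exact (tendsto_inv_atTop_nhds_zero_nat (𝕜 := ℂ)).smul h

variable [IsTopologicalAddGroup H]

theorem HasInvExpansion.add {L : ℕ} {ρ σ : ℕ → H} {A B : H} (hρ : HasInvExpansion L ρ A)
    (hσ : HasInvExpansion L σ B) : HasInvExpansion L (fun m ↦ ρ m + σ m) (A + B) := by
  induction L generalizing ρ σ A B with
  | zero => exact Tendsto.add hρ hσ
  | succ L ih =>
    obtain ⟨A₁, hA⟩ := hρ
    obtain ⟨B₁, hB⟩ := hσ
    refine ⟨A₁ + B₁, (ih hA hB).congr (.of_forall fun m ↦ ?_)⟩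
    simp only
    rw [← smul_add, add_sub_add_comm]

theorem hasInvExpansion_of_eventuallyEq {L : ℕ} {ρ : ℕ → H} {A R : ℕ → H}
    (hR : Tendsto R atTop (𝓝 0)) (h : ∀ᶠ m : ℕ in atTop, ρ m =
      ∑ l ∈ Finset.range (L + 1), ((m : ℂ) ^ l)⁻¹ • A l + ((m : ℂ) ^ L)⁻¹ • R m) :
    HasInvExpansion L ρ (A 0) := by
  induction L generalizing ρ A with
  | zero =>
    have h1 := hR.const_add (A 0)
    rw [add_zero] at h1
    exact Tendsto.congr' (h.mono fun m hm ↦ by simp [hm]) h1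
  | succ L ih =>
    refine ⟨A 1, ih (A := fun l ↦ A (l + 1)) ?_⟩
    filter_upwards [h, eventually_gt_atTop 0] with m hm hm0
    have hm' : (m : ℂ) ≠ 0 := Nat.cast_ne_zero.2 hm0.ne'
    have hp : ∀ l, (m : ℂ) * ((m : ℂ) ^ (l + 1))⁻¹ = ((m : ℂ) ^ l)⁻¹ := fun l ↦ by
      rw [pow_succ]
      field_simp
    rw [hm, Finset.sum_range_succ' _ (L + 1), pow_zero, inv_one, one_smul, add_right_comm,
      add_sub_cancel_right, smul_add, Finset.smul_sum]
    simp only [smul_smul, hp]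

variable [ContinuousSMul ℂ H]

theorem HasInvExpansion.of_succ {L : ℕ} {ρ : ℕ → H} {A : H} (h : HasInvExpansion (L + 1) ρ A) :
    HasInvExpansion L ρ A := by
  induction L generalizing ρ A with
  | zero =>
    obtain ⟨A₁, h⟩ := h
    have h1 := (tendsto_inv_natCast_smul h).add_const A
    rw [zero_add] at h1
    refine Tendsto.congr' ?_ h1
    filter_upwards [eventually_gt_atTop 0] with m hm
    have hm' : (m : ℂ) ≠ 0 := Nat.cast_ne_zero.2 hm.ne'
    rw [inv_smul_smul₀ hm', sub_add_cancel]
  | succ L ih =>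
    obtain ⟨A₁, h⟩ := h
    exact ⟨A₁, ih h⟩

theorem HasInvExpansion.tendsto {L : ℕ} {ρ : ℕ → H} {A : H} (h : HasInvExpansion L ρ A) :
    Tendsto ρ atTop (𝓝 A) := by
  induction L with
  | zero => exact h
  | succ L ih => exact ih h.of_succ

theorem HasInvExpansion.const_mul [T2Space H] [FiniteDimensional ℂ H] {L : ℕ}
    {ρ : ℕ → H} {A : H} (h : HasInvExpansion L ρ A) (c : H) :
    HasInvExpansion L (fun m ↦ c * ρ m) (c * A) := by
  induction L generalizing ρ A with
  | zero => exact tendsto_const_mul c h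
  | succ L ih =>
    obtain ⟨A₁, h⟩ := h
    refine ⟨c * A₁, (ih h).congr (.of_forall fun m ↦ ?_)⟩
    simp only
    rw [mul_smul_comm, mul_sub]

end Expansion

/-! ### Asymptotics of the series with coefficients in an algebra -/

section MittagLefflerAlgebra

variable {H : Type*} [Ring H] [Algebra ℂ H] {b : H}

theorem taylorAt_comp_add_const (z₀ c : ℂ) (f : ℂ → ℂ) :
    taylorAt z₀ b (fun z ↦ f (z + c)) = taylorAt (z₀ + c) b f := by
  simp only [taylorAt, iteratedDeriv_comp_add_const]

theorem differentiable_pow_mul_mlTerm (ξ : ℂ) (n : ℕ) (x : ℝ) :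
    Differentiable ℂ fun z ↦ ξ ^ n * mlTerm n x z :=
  (differentiable_mlTerm n x).const_mul _

/-- Since `1 / Γ(s) = s / Γ(s + 1)`, a coefficient growing linearly in `m` may be traded for raising
`β` by one. -/
theorem taylorAt_mlTerm_mul (hb : IsNilpotent b) (z₀ ξ : ℂ) (n : ℕ) {x : ℝ} (hx : 0 < x) (ρ : H) :
    taylorAt z₀ b (fun z ↦ ξ ^ n * mlTerm n x z) * ρ =
      (x : ℂ)⁻¹ • (taylorAt (z₀ + 1) b (fun z ↦ ξ ^ n * mlTerm n x z) *
        ((algebraMap ℂ H (n + (z₀ + 1)) + b) * ρ)) := by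
  have e : (fun z ↦ ξ ^ n * mlTerm n x z) = fun z ↦ (x : ℂ)⁻¹ *
      (fun y ↦ (ξ ^ n * mlTerm n x y) * (n + y)) (z + 1) := by
    funext z
    rw [mlTerm_eq_inv_mul n hx]
    ring
  conv_lhs => rw [e]
  rw [taylorAt_const_mul, taylorAt_comp_add_const z₀ 1 fun y ↦ ξ ^ n * mlTerm n x y * (n + y),
    taylorAt_mul hb
    ((differentiable_pow_mul_mlTerm ξ n x).analyticAt _) (by fun_prop), taylorAt_const_add hb,
    smul_mul_assoc, mul_assoc]

variable [TopologicalSpace H]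

/-- The sum `∑ₘ ξ^{rm} x^{rm+β} / Γ(1+rm+β) ρₘ` for `β = z₀ + b`, with coefficients `ρₘ` in the
algebra. -/
noncomputable def mlSum (r : ℕ) (ξ : ℂ) (b : H) (z₀ : ℂ) (ρ : ℕ → H) (x : ℝ) : H :=
  ∑' m, taylorAt z₀ b (fun z ↦ ξ ^ (r * m) * mlTerm (r * m) x z) * ρ m

/-- The coefficient of `eˣ` in `∑ₘ ξ^{rm} x^{rm+z} / Γ(1+rm+z)`. -/
noncomputable def mlDensity (r : ℕ) (ξ : ℂ) : ℂ := if ξ ^ r = 1 then 1 / r else 0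

variable [IsTopologicalAddGroup H] [ContinuousSMul ℂ H] [T2Space H] [FiniteDimensional ℂ H]

theorem norm_pow_mul_mlTerm {ξ : ℂ} (hξ : ‖ξ‖ = 1) (n : ℕ) (x : ℝ) (z : ℂ) :
    ‖ξ ^ n * mlTerm n x z‖ = ‖mlTerm n x z‖ := by
  rw [norm_mul, norm_pow, hξ, one_pow, one_mul]

theorem Nat.mul_left_injective_of_pos {r : ℕ} (hr : 0 < r) :
    Function.Injective fun m : ℕ ↦ r * m := fun _ _ h ↦ Nat.eq_of_mul_eq_mul_left hr h

variable {r : ℕ} {ξ : ℂ}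

theorem summable_mlSum (hr : 0 < r) (hξ : ‖ξ‖ = 1) (z₀ : ℂ) {ρ : ℕ → H} {A : H}
    (hρ : Tendsto ρ atTop (𝓝 A)) {x : ℝ} (hx : 0 < x) :
    Summable fun m ↦ taylorAt z₀ b (fun z ↦ ξ ^ (r * m) * mlTerm (r * m) x z) * ρ m := by
  obtain ⟨M, C, -, hM, hMs, -, -⟩ := exists_mlTerm_majorant z₀
  refine (hasSum_taylorAt_mul (M := fun m ↦ M (r * m) x)
    (fun m ↦ (differentiable_pow_mul_mlTerm ξ (r * m) x).differentiableOn) (fun m z hz ↦ ?_)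
    ((hMs x hx).comp_injective (Nat.mul_left_injective_of_pos hr)) hρ).summable
  rw [norm_pow_mul_mlTerm hξ]
  exact hM _ x hx z hz

/-- Coefficients tending to zero contribute only `o(eˣ)`. -/
theorem tendsto_exp_neg_smul_mlSum_zero (hr : 0 < r) (hξ : ‖ξ‖ = 1) (z₀ : ℂ) {ρ : ℕ → H}
    (hρ : Tendsto ρ atTop (𝓝 0)) :
    Tendsto (fun x : ℝ ↦ (Real.exp (-x) : ℂ) • mlSum r ξ b z₀ ρ x) atTop (𝓝 0) := by
  obtain ⟨M, C, hM0, hM, hMs, hMC, hMn⟩ := exists_mlTerm_majorant z₀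
  have hinj := Nat.mul_left_injective_of_pos hr
  have h := tendsto_tsum_taylorAt_mul_zero (l := atTop) (b := b) (z₀ := z₀) (ρ := ρ) (C := C)
    (f := fun m (x : ℝ) z ↦ (Real.exp (-x) : ℂ) * (ξ ^ (r * m) * mlTerm (r * m) x z))
    (M := fun m x ↦ Real.exp (-x) * M (r * m) x)
    (fun m x ↦ ((differentiable_pow_mul_mlTerm ξ (r * m) x).const_mul _).differentiableOn)
    ?_ ?_ ?_ ?_ hρ
  · refine h.congr' ?_
    filter_upwards [eventually_gt_atTop 0] with x hx
    simp only [taylorAt_const_mul (Real.exp (-x) : ℂ), smul_mul_assoc]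
    rw [(summable_mlSum hr hξ z₀ hρ hx).tsum_const_smul]
    rfl
  · filter_upwards [eventually_gt_atTop 0] with x hx n z hz
    rw [norm_mul, norm_pow_mul_mlTerm hξ, Complex.norm_real,
      Real.norm_of_nonneg (Real.exp_pos _).le]
    exact mul_le_mul_of_nonneg_left (hM _ x hx z hz) (Real.exp_pos _).le
  · filter_upwards [eventually_gt_atTop 0] with x hx
    exact ((hMs x hx).comp_injective hinj).mul_left _
  · filter_upwards [eventually_gt_atTop 0, hMC] with x hx hx'
    rw [tsum_mul_left, Real.exp_neg, inv_mul_le_iff₀ (Real.exp_pos x), mul_comm]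
    exact (tsum_comp_le_tsum_of_inj (hMs x hx) (fun n ↦ hM0 n x hx) hinj).trans hx'
  · intro m
    simpa [mul_comm] using hMn (r * m) 0

/-- With constant coefficients the sum is a multiple of `eˣ`, up to an error smaller than
`x⁻ᴸ eˣ` for every `L`. -/
theorem tendsto_mlSum_const (hr : 0 < r) (hξ : ‖ξ‖ = 1) (hb : IsNilpotent b) (z₀ : ℂ) (A : H)
    (L : ℕ) : Tendsto (fun x : ℝ ↦ (x : ℂ) ^ L •
      ((Real.exp (-x) : ℂ) • mlSum r ξ b z₀ (fun _ ↦ A) x - mlDensity r ξ • A)) atTop (𝓝 0) := by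
  obtain ⟨M, C, hM0, hM, hMs, hMC, hMn⟩ := exists_mlTerm_majorant z₀
  obtain ⟨E, hE, hE'⟩ := exists_norm_tsum_mlTerm_multiples_sub_le hr hξ z₀
  have hinj := Nat.mul_left_injective_of_pos hr
  let F : ℝ → ℂ → ℂ := fun x z ↦ ∑' m, ξ ^ (r * m) * mlTerm (r * m) x z
  have hMx : ∀ x, 0 < x → ∀ m, ∀ z ∈ Metric.ball z₀ 1,
      ‖ξ ^ (r * m) * mlTerm (r * m) x z‖ ≤ M (r * m) x := fun x hx m z hz ↦ by
    rw [norm_pow_mul_mlTerm hξ]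
    exact hM _ x hx z hz
  have hFd : ∀ x, 0 < x → DifferentiableOn ℂ (F x) (Metric.ball z₀ 1) := fun x hx ↦
    Complex.differentiableOn_tsum_of_summable_norm ((hMs x hx).comp_injective hinj)
      (fun m ↦ (differentiable_pow_mul_mlTerm ξ (r * m) x).differentiableOn) Metric.isOpen_ball
      (hMx x hx)
  have h := tendsto_taylorAt_zero (l := atTop) (b := b) (z₀ := z₀)
    (F := fun (x : ℝ) z ↦ ((x : ℂ) ^ L * (Real.exp (-x) : ℂ)) *
      (F x z - mlDensity r ξ * (Real.exp x : ℂ)))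
    (M := fun x ↦ E x * x ^ L * Real.exp (-x)) ?_ ?_ (hE L)
  · have h' := ((LinearMap.mulRight ℂ A).continuous_of_finiteDimensional.tendsto 0).comp h
    rw [map_zero] at h'
    refine h'.congr' ?_
    filter_upwards [eventually_gt_atTop 0] with x hx
    have hsum := hasSum_taylorAt hb
      (fun m ↦ (differentiable_pow_mul_mlTerm ξ (r * m) x).differentiableOn) (hMx x hx)
      ((hMs x hx).comp_injective hinj)
    have hml : mlSum r ξ b z₀ (fun _ ↦ A) x = taylorAt z₀ b (F x) * A :=
      (hsum.mul_const_of_finiteDimensional A).tsum_eq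
    simp only [Function.comp, LinearMap.mulRight_apply]
    rw [taylorAt_const_mul, taylorAt_sub ((hFd x hx).analyticAt (Metric.ball_mem_nhds _ one_pos))
      analyticAt_const, taylorAt_const hb, hml, mul_smul, Algebra.algebraMap_eq_smul_one,
      smul_mul_assoc, smul_mul_assoc, sub_mul, smul_mul_assoc, one_mul, smul_sub (_ : ℂ) (_ * A),
      smul_smul (Real.exp (-x) : ℂ), mul_left_comm, ← Complex.ofReal_mul, ← Real.exp_add]
    simp
  · filter_upwards [eventually_gt_atTop 0] with x hx
    exact ((hFd x hx).sub (differentiableOn_const _)).const_mul _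
  · filter_upwards [eventually_gt_atTop 0, hE'] with x hx hx' z hz
    have hd : mlDensity r ξ * (Real.exp x : ℂ) =
        if ξ ^ r = 1 then (1 / r * Real.exp x : ℂ) else 0 := by
      rw [mlDensity]
      split_ifs <;> simp
    rw [hd, norm_mul, norm_mul, norm_pow, Complex.norm_real, Complex.norm_real,
      Real.norm_of_nonneg hx.le, Real.norm_of_nonneg (Real.exp_pos _).le]
    calc x ^ L * Real.exp (-x) * _ ≤ x ^ L * Real.exp (-x) * E x := by
          refine mul_le_mul_of_nonneg_left (hx' z hz) (by positivity)
      _ = _ := by ring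

/-- The expansion of `mlSum`, by induction on the order: the leading coefficient is split off, and
the rest is a sum of the same kind with `β + 1` in place of `β`. -/
theorem exists_expansion_mlSum (hr : 0 < r) (hξ : ‖ξ‖ = 1) (hb : IsNilpotent b) {L : ℕ} (z₀ : ℂ)
    {ρ : ℕ → H} {A : H} (hρ : HasInvExpansion L ρ A) : ∃ B : ℕ → H, B 0 = A ∧
      Tendsto (fun x : ℝ ↦ (x : ℂ) ^ L • ((Real.exp (-x) : ℂ) • mlSum r ξ b z₀ ρ x -
        mlDensity r ξ • ∑ l ∈ Finset.range (L + 1), ((x : ℂ) ^ l)⁻¹ • B l)) atTop (𝓝 0) := by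
  have hsplit : ∀ (z₀ : ℂ) {ρ : ℕ → H} {A : H}, Tendsto ρ atTop (𝓝 A) → ∀ {x : ℝ}, 0 < x →
      mlSum r ξ b z₀ ρ x = mlSum r ξ b z₀ (fun _ ↦ A) x + mlSum r ξ b z₀ (fun m ↦ ρ m - A) x := by
    intro z₀ ρ A h x hx
    have h0 : Tendsto (fun m ↦ ρ m - A) atTop (𝓝 0) := by simpa using h.sub_const A
    rw [mlSum, mlSum, mlSum, ← (summable_mlSum hr hξ z₀ tendsto_const_nhds hx).tsum_add
      (summable_mlSum hr hξ z₀ h0 hx)]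
    simp only [← mul_add, add_sub_cancel]
  induction L generalizing z₀ ρ A with
  | zero =>
    refine ⟨fun _ ↦ A, rfl, ?_⟩
    have h0 : Tendsto (fun m ↦ ρ m - A) atTop (𝓝 0) := by simpa using Tendsto.sub_const hρ A
    have h := (tendsto_mlSum_const hr hξ hb z₀ A 0).add
      (tendsto_exp_neg_smul_mlSum_zero (b := b) hr hξ z₀ h0)
    rw [add_zero] at h
    refine h.congr' ?_
    filter_upwards [eventually_gt_atTop 0] with x hx
    rw [hsplit z₀ hρ hx, smul_add]
    simp only [pow_zero, one_smul, zero_add, Finset.sum_range_one, inv_one]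
    abel
  | succ L ih =>
    have hρA := hρ.of_succ
    obtain ⟨A₁, hρ₁⟩ := hρ
    have hσ : HasInvExpansion L (fun m ↦ ρ m - A) 0 := by
      have := hρA.add (hasInvExpansion_const L (-A))
      rw [add_neg_cancel] at this
      exact this.congr (.of_forall fun m ↦ (sub_eq_add_neg _ _).symm)
    have hτ : HasInvExpansion L
        (fun m ↦ (algebraMap ℂ H ((r * m : ℕ) + (z₀ + 1)) + b) * (ρ m - A))
        (algebraMap ℂ H r * A₁ + (algebraMap ℂ H (z₀ + 1) + b) * 0) := by
      refine ((hρ₁.const_mul (algebraMap ℂ H r)).add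
        (hσ.const_mul (algebraMap ℂ H (z₀ + 1) + b))).congr (.of_forall fun m ↦ ?_)
      simp only [map_add, add_mul, Nat.cast_mul, map_mul, ← add_assoc]
      rw [mul_assoc, ← Algebra.smul_def (m : ℂ)]
    obtain ⟨B, -, hB⟩ := ih (z₀ + 1) hτ
    refine ⟨fun l ↦ Nat.casesOn l A B, rfl, ?_⟩
    have h := (tendsto_mlSum_const hr hξ hb z₀ A (L + 1)).add hB
    rw [add_zero] at h
    refine h.congr' ?_
    filter_upwards [eventually_gt_atTop 0] with x hx
    have hx' : (x : ℂ) ≠ 0 := Complex.ofReal_ne_zero.2 hx.ne'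
    have hshift : mlSum r ξ b z₀ (fun m ↦ ρ m - A) x = (x : ℂ)⁻¹ • mlSum r ξ b (z₀ + 1)
        (fun m ↦ (algebraMap ℂ H ((r * m : ℕ) + (z₀ + 1)) + b) * (ρ m - A)) x := by
      rw [mlSum, mlSum, ← (summable_mlSum hr hξ (z₀ + 1) hτ.tendsto hx).tsum_const_smul]
      simp only [taylorAt_mlTerm_mul hb z₀ ξ _ hx]
    have hsum : ∑ l ∈ Finset.range (L + 1 + 1), ((x : ℂ) ^ l)⁻¹ •
        (Nat.casesOn l A B : H) = (x : ℂ)⁻¹ • (∑ l ∈ Finset.range (L + 1),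
          ((x : ℂ) ^ l)⁻¹ • B l) + A := by
      rw [Finset.sum_range_succ', Finset.smul_sum, pow_zero, inv_one, one_smul]
      refine congrArg (· + A) (Finset.sum_congr rfl fun l _ ↦ ?_)
      rw [smul_smul, pow_succ, mul_inv, mul_comm]
    rw [hsum, hsplit z₀ hρA.tendsto hx, hshift, pow_succ]
    generalize mlSum r ξ b (z₀ + 1) _ x = S
    generalize mlSum r ξ b z₀ _ x = S'
    generalize ∑ l ∈ Finset.range (L + 1), ((x : ℂ) ^ l)⁻¹ • B l = S''
    simp only [smul_sub, smul_add, smul_smul]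
    have e1 : (x : ℂ) ^ L * x * ((Real.exp (-x) : ℂ) * (x : ℂ)⁻¹) =
        x ^ L * (Real.exp (-x) : ℂ) := by
      field_simp
    have e2 : (x : ℂ) ^ L * x * (mlDensity r ξ * (x : ℂ)⁻¹) = x ^ L * mlDensity r ξ := by
      field_simp
    rw [e1, e2]
    abel

end MittagLefflerAlgebra

/-! ### The exponential and Gamma functions on cohomology classes -/

section CohomologyFunctions

theorem taylorAt_comp_const_add {H : Type*} [Ring H] [Algebra ℂ H] (z₀ c : ℂ) (b : H) (f : ℂ → ℂ) :
    taylorAt z₀ b (fun z ↦ f (c + z)) = taylorAt (c + z₀) b f := by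
  simp only [taylorAt, iteratedDeriv_comp_const_add]

theorem taylorAt_exp_smul {H : Type*} [Ring H] [Algebra ℂ H] {b : H} (hb : IsNilpotent b)
    (w z₀ : ℂ) : taylorAt (w * z₀) (w • b) Complex.exp =
      taylorAt z₀ b (fun z ↦ Complex.exp (w * z)) := by
  obtain ⟨N, hN⟩ := hb
  rw [taylorAt_eq_sum_range (N := N) (by rw [smul_pow, hN, smul_zero]), taylorAt_eq_sum_range hN]
  refine Finset.sum_congr rfl fun k _ ↦ ?_
  rw [iteratedDeriv_comp_const_mul Complex.contDiff_exp, smul_pow, smul_smul]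
  simp only [iteratedDeriv_eq_iterate, Complex.iter_deriv_exp]
  congr 1
  ring

variable {X : Type*} [TopologicalSpace X] [Nonempty X]

theorem degZero_smul_natCast_add (w : ℂ) (n : ℕ) (β : Cohomology X) :
    degZero (w • ((n : Cohomology X) + β)) = w * (n + degZero β) := by
  simp [degZero, mul_add]

theorem degPos_smul_natCast_add (w : ℂ) (n : ℕ) (β : Cohomology X) :
    degPos (w • ((n : Cohomology X) + β)) = w • degPos β := by
  rw [degPos, degZero_smul_natCast_add, degPos, map_mul, map_add, map_natCast,
    ← Algebra.smul_def, ← smul_sub, add_sub_add_left_eq_sub]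

theorem exp_smul_natCast_add (w : ℂ) (n : ℕ) {β : Cohomology X} (hβ : IsNilpotent (degPos β)) :
    Cohomology.exp (w • ((n : Cohomology X) + β)) =
      taylorAt (degZero β) (degPos β) (fun z ↦ Complex.exp (w * (n + z))) := by
  rw [taylorAt_comp_const_add (f := fun z ↦ Complex.exp (w * z)), ← taylorAt_exp_smul hβ,
    ← degZero_smul_natCast_add, ← degPos_smul_natCast_add w n]
  rfl

theorem cis_eq_taylorAt (ψ : ℝ) {β : Cohomology X} (hβ : IsNilpotent (degPos β)) :
    Cohomology.cis ψ β =
      taylorAt (degZero β) (degPos β) (fun z ↦ Complex.exp (Complex.I * ψ * z)) := by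
  have h := exp_smul_natCast_add (Complex.I * ψ) 0 hβ
  simp only [Nat.cast_zero, zero_add] at h
  exact h

theorem cis_mul_cis_neg (ψ : ℝ) {β : Cohomology X} (hβ : IsNilpotent (degPos β)) :
    Cohomology.cis ψ β * Cohomology.cis (-ψ) β = 1 := by
  rw [cis_eq_taylorAt ψ hβ, cis_eq_taylorAt (-ψ) hβ, ← taylorAt_mul hβ (by fun_prop) (by fun_prop)]
  have e : (fun z : ℂ ↦ Complex.exp (Complex.I * ψ * z) * Complex.exp (Complex.I * (-ψ : ℝ) * z)) =
      fun _ ↦ 1 := by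
    funext z
    rw [← Complex.exp_add, Complex.ofReal_neg, ← Complex.exp_zero]
    congr 1
    ring
  rw [e, taylorAt_const hβ, map_one]

theorem Gamma_one_add_natCast_add (n : ℕ) (β : Cohomology X) :
    Cohomology.Gamma (1 + (n : Cohomology X) + β) =
      taylorAt (degZero β) (degPos β) (fun z ↦ Complex.Gamma (1 + n + z)) := by
  have h0 : degZero (1 + (n : Cohomology X) + β) = 1 + n + degZero β := by simp [degZero]
  have h1 : degPos (1 + (n : Cohomology X) + β) = degPos β := by
    rw [degPos, h0, degPos, map_add, map_add, map_one, map_natCast, add_sub_add_left_eq_sub]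
  rw [taylorAt_comp_const_add (f := Complex.Gamma), ← h0, ← h1]
  rfl

theorem inverse_Gamma_one_add_natCast_add {n : ℕ} {β : Cohomology X}
    (hβ : IsNilpotent (degPos β)) (hn : 0 < 1 + n + (degZero β).re) :
    Ring.inverse (Cohomology.Gamma (1 + (n : Cohomology X) + β)) =
      taylorAt (degZero β) (degPos β) (fun z ↦ (Complex.Gamma (1 + n + z))⁻¹) := by
  set z₀ := degZero β
  have hopen : IsOpen {z : ℂ | 0 < 1 + n + z.re} :=
    isOpen_lt continuous_const (by fun_prop)
  have hnhds : {z : ℂ | 0 < 1 + n + z.re} ∈ 𝓝 z₀ := hopen.mem_nhds hn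
  have hre : ∀ z : ℂ, 0 < 1 + n + z.re → 0 < (1 + n + z : ℂ).re := fun z hz ↦ by simpa using hz
  have ha : AnalyticAt ℂ (fun z ↦ Complex.Gamma (1 + n + z)) z₀ := by
    refine DifferentiableOn.analyticAt (s := {z : ℂ | 0 < 1 + n + z.re}) (fun z hz ↦ ?_) hnhds
    refine DifferentiableAt.differentiableWithinAt ?_
    refine DifferentiableAt.comp (g := Complex.Gamma) (f := fun z : ℂ ↦ 1 + n + z) z
      (Complex.differentiableAt_Gamma _ fun m h ↦ ?_) (by fun_prop)
    have h1 := hre z hz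
    rw [h] at h1
    simp only [Complex.neg_re, Complex.natCast_re] at h1
    have : (0 : ℝ) ≤ m := m.cast_nonneg
    linarith
  have hi : AnalyticAt ℂ (fun z ↦ (Complex.Gamma (1 + n + z))⁻¹) z₀ :=
    (Complex.differentiable_one_div_Gamma.comp
      (f := fun z : ℂ ↦ 1 + n + z) (by fun_prop)).analyticAt z₀
  have h1 : taylorAt z₀ (degPos β) (fun z ↦ Complex.Gamma (1 + n + z)) *
      taylorAt z₀ (degPos β) (fun z ↦ (Complex.Gamma (1 + n + z))⁻¹) = 1 := by
    rw [← taylorAt_mul hβ ha hi, taylorAt_congr (g := fun _ ↦ 1), taylorAt_const hβ, map_one]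
    filter_upwards [hnhds] with z hz
    exact mul_inv_cancel₀ (Complex.Gamma_ne_zero_of_re_pos (hre z hz))
  have h2 : taylorAt z₀ (degPos β) (fun z ↦ (Complex.Gamma (1 + n + z))⁻¹) *
      taylorAt z₀ (degPos β) (fun z ↦ Complex.Gamma (1 + n + z)) = 1 := by
    rw [← h1, ← taylorAt_mul hβ ha hi, ← taylorAt_mul hβ hi ha]
    simp only [mul_comm]
  rw [Gamma_one_add_natCast_add]
  exact Ring.inverse_unit ⟨_, _, h1, h2⟩

/-- Where `1 + rm + β` is not a pole of `Γ`, the term of the series is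
`e^{i(θ+φ)β} · e^{i(θ+φ)rm} (Ts)^{rm+β} / Γ(1+rm+β) · ρ`. -/
theorem exp_mul_mittagLefflerCoeff {r : ℕ} {β : Cohomology X} (hβ : IsNilpotent (degPos β))
    {T : ℝ} (hT : 0 < T) (θ φ : ℝ) {s : ℝ} (hs : 0 < s) {m : ℕ}
    (hm : 0 < 1 + (r * m : ℕ) + (degZero β).re) :
    Cohomology.exp (((Real.log s : ℂ) + Complex.I * φ) • (((r * m : ℕ) : Cohomology X) + β)) *
      mittagLefflerCoeff r β T θ m = Cohomology.cis (θ + φ) β *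
        taylorAt (degZero β) (degPos β) (fun z ↦
          Complex.exp (Complex.I * (θ + φ : ℝ)) ^ (r * m) * mlTerm (r * m) (T * s) z) := by
  have hi : AnalyticAt ℂ (fun z ↦ (Complex.Gamma (1 + (r * m : ℕ) + z))⁻¹) (degZero β) :=
    (Complex.differentiable_one_div_Gamma.comp
      (f := fun z : ℂ ↦ 1 + (r * m : ℕ) + z) (by fun_prop)).analyticAt _
  rw [mittagLefflerCoeff, rpow, Cohomology.cis, inverse_Gamma_one_add_natCast_add hβ hm,
    exp_smul_natCast_add _ _ hβ, exp_smul_natCast_add _ _ hβ, exp_smul_natCast_add _ _ hβ,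
    cis_eq_taylorAt _ hβ, ← taylorAt_mul hβ (by fun_prop) (by fun_prop),
    ← taylorAt_mul hβ (by fun_prop) hi, ← taylorAt_mul hβ (by fun_prop) (by fun_prop),
    ← taylorAt_mul hβ (by fun_prop) ((differentiable_pow_mul_mlTerm _ _ _).analyticAt _)]
  congr 1
  funext z
  rw [mlTerm, ← Complex.exp_nat_mul, Real.log_mul hT.ne' hs.ne']
  simp only [← mul_assoc, ← Complex.exp_add]
  congr 2
  push_cast
  ring

end CohomologyFunctions

/-! ### Asymptotics of the sum of the series -/

section SeriesAsymptotics

variable {X : Type*} [TopologicalSpace X]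

instance : IsTopologicalAddGroup (Cohomology X) := IsModuleTopology.topologicalAddGroup ℂ _

instance [FiniteDimensional ℂ (Cohomology X)] : T2Space (Cohomology X) :=
  T2Space.of_injective_continuous (Module.finBasis ℂ (Cohomology X)).equivFun.injective
    (IsModuleTopology.continuous_of_linearMap
      (Module.finBasis ℂ (Cohomology X)).equivFun.toLinearMap)

variable [Nonempty X] [FiniteDimensional ℂ (Cohomology X)]

/-- A single term of the series is negligible compared with `e^{Ts}`. -/
theorem tendsto_exp_smul_seriesTerm (r : ℕ) (a : ℕ → Cohomology X) {β : Cohomology X}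
    (hβ : IsNilpotent (degPos β)) {T : ℝ} (hT : 0 < T) (φ : ℝ) (m L : ℕ) :
    Tendsto (fun s : ℝ ↦ ((s : ℂ) ^ L * (Real.exp (-(T * s)) : ℂ)) • seriesTerm r a β φ s m)
      atTop (𝓝 0) := by
  set z₀ := degZero β
  set p : ℝ := (r * m : ℕ) + z₀.re + 1
  have hM : Tendsto (fun s : ℝ ↦ Real.exp (|φ| * (|z₀.im| + 1)) *
      (s ^ (p + L) * Real.exp (-T * s))) atTop (𝓝 0) := by
    simpa using (tendsto_rpow_mul_exp_neg_mul_atTop_nhds_zero (p + L) T hT).const_mul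
      (Real.exp (|φ| * (|z₀.im| + 1)))
  have h := tendsto_taylorAt_zero (b := degPos β) (z₀ := z₀)
    (F := fun (s : ℝ) z ↦ ((s : ℂ) ^ L * (Real.exp (-(T * s)) : ℂ)) *
      Complex.exp (((Real.log s : ℂ) + Complex.I * φ) * ((r * m : ℕ) + z)))
    (.of_forall fun s ↦ by fun_prop) ?_ hM
  · have h' := ((LinearMap.mulRight ℂ (a m)).continuous_of_finiteDimensional.tendsto 0).comp h
    rw [map_zero] at h'
    refine h'.congr fun s ↦ ?_
    simp only [Function.comp, LinearMap.mulRight_apply]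
    rw [taylorAt_const_mul, seriesTerm, exp_smul_natCast_add _ _ hβ, smul_mul_assoc]
  · filter_upwards [eventually_ge_atTop 1] with s hs z hz
    have hs0 : 0 < s := by linarith
    have hre := (abs_lt.1 (abs_re_sub_lt hz)).2
    have him : |z.im| ≤ |z₀.im| + 1 := by
      have h1 : |z.im - z₀.im| ≤ 1 := by
        rw [← Complex.sub_im]
        exact (Complex.abs_im_le_norm _).trans
          (by simpa [dist_eq_norm] using (Metric.mem_ball.1 hz).le)
      have h2 := abs_sub_abs_le_abs_sub z.im z₀.im
      linarith
    have he : ‖Complex.exp (((Real.log s : ℂ) + Complex.I * φ) * ((r * m : ℕ) + z))‖ ≤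
        Real.exp (|φ| * (|z₀.im| + 1)) * s ^ p := by
      rw [Complex.norm_exp, Real.rpow_def_of_pos hs0, ← Real.exp_add, Real.exp_le_exp]
      have e : ((((Real.log s : ℂ) + Complex.I * φ) * ((r * m : ℕ) + z)).re : ℝ) =
          Real.log s * ((r * m : ℕ) + z.re) - φ * z.im := by
        simp
      rw [e]
      have h1 : -(φ * z.im) ≤ |φ| * (|z₀.im| + 1) :=
        (neg_le_abs _).trans (by rw [abs_mul]; gcongr)
      have h2 : Real.log s * ((r * m : ℕ) + z.re) ≤ Real.log s * p :=
        mul_le_mul_of_nonneg_left (by simp only [p]; linarith) (Real.log_nonneg hs)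
      linarith
    rw [norm_mul, norm_mul, norm_pow, Complex.norm_real, Complex.norm_real,
      Real.norm_of_nonneg hs0.le, Real.norm_of_nonneg (Real.exp_pos _).le]
    calc s ^ L * Real.exp (-(T * s)) * _ ≤ s ^ L * Real.exp (-(T * s)) *
          (Real.exp (|φ| * (|z₀.im| + 1)) * s ^ p) :=
          mul_le_mul_of_nonneg_left he (by positivity)
      _ = _ := by
        rw [Real.rpow_add hs0 p, Real.rpow_natCast, neg_mul]
        ring

/-- The common form of all the assertions: an expansion of the coefficients in powers of `1 / m`
yields one of the sum of the series in powers of `1 / s`. -/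
theorem exists_expansion_seriesSum {r : ℕ} (hr : 0 < r) (a : ℕ → Cohomology X) {β : Cohomology X}
    (hβ : IsNilpotent (degPos β)) {T : ℝ} (hT : 0 < T) (θ φ : ℝ) {L : ℕ} {ρ : ℕ → Cohomology X}
    {A : Cohomology X} (hρ : HasInvExpansion L ρ A)
    (ha : ∀ᶠ m in atTop, a m = mittagLefflerCoeff r β T θ m * ρ m) :
    (∀ s : ℝ, 0 < s → Summable (seriesTerm r a β φ s)) ∧
    ∃ B : ℕ → Cohomology X, B 0 = A ∧ ∃ R : ℝ → Cohomology X, Tendsto R atTop (𝓝 0) ∧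
      ∀ᶠ s : ℝ in atTop, seriesSum r a β φ s = (Real.exp (T * s) : ℂ) •
        (Cohomology.cis (θ + φ) β * (mlDensity r (Complex.exp (Complex.I * (θ + φ : ℝ))) •
          ∑ l ∈ Finset.range (L + 1), ((T * s : ℂ) ^ l)⁻¹ • B l) + ((s : ℂ) ^ L)⁻¹ • R s) := by
  set ξ := Complex.exp (Complex.I * (θ + φ : ℝ)) with hξ_def
  set z₀ := degZero β
  set b := degPos β
  set u := Cohomology.cis (θ + φ) β
  have hξ : ‖ξ‖ = 1 := by rw [hξ_def, mul_comm, Complex.norm_exp_ofReal_mul_I]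
  have hpole : ∀ᶠ m : ℕ in atTop, 0 < 1 + ((r * m : ℕ) : ℝ) + z₀.re := by
    obtain ⟨N, hN⟩ := exists_nat_gt (-z₀.re)
    filter_upwards [eventually_ge_atTop N] with m hm
    have : (N : ℝ) ≤ (r * m : ℕ) := by exact_mod_cast hm.trans (Nat.le_mul_of_pos_left m hr)
    linarith
  obtain ⟨N, hN⟩ := eventually_atTop.1 (ha.and hpole)
  -- the finitely many coefficients that are not controlled are split off
  let ρ' : ℕ → Cohomology X := fun m ↦ if m < N then 0 else ρ m
  have hρ' : HasInvExpansion L ρ' A := hρ.congr (by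
    filter_upwards [eventually_ge_atTop N] with m hm
    exact (if_neg (not_lt.2 hm)).symm)
  have hterm : ∀ s, 0 < s → ∀ m, seriesTerm r a β φ s m =
      u * (taylorAt z₀ b (fun z ↦ ξ ^ (r * m) * mlTerm (r * m) (T * s) z) * ρ' m) +
        if m < N then seriesTerm r a β φ s m else 0 := by
    intro s hs m
    by_cases hm : m < N
    · simp [ρ', hm]
    · obtain ⟨h1, h2⟩ := hN m (not_lt.1 hm)
      simp only [ρ', hm, if_false, add_zero]
      rw [seriesTerm, h1, ← mul_assoc, exp_mul_mittagLefflerCoeff hβ hT θ φ hs h2, mul_assoc]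
  have hsum : ∀ s, 0 < s → HasSum (seriesTerm r a β φ s)
      (u * mlSum r ξ b z₀ ρ' (T * s) + ∑ m ∈ Finset.range N, seriesTerm r a β φ s m) := by
    intro s hs
    have h1 := (summable_mlSum (b := b) hr hξ z₀ hρ'.tendsto
      (mul_pos hT hs)).hasSum.const_mul_of_finiteDimensional u
    have h2 := hasSum_sum_of_ne_finset_zero (L := .unconditional ℕ)
      (f := fun m ↦ if m < N then seriesTerm r a β φ s m else 0)
      (s := Finset.range N) (fun m hm ↦ if_neg (by simpa using hm))
    rw [Finset.sum_congr rfl (fun m hm ↦ if_pos (Finset.mem_range.1 hm))] at h2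
    exact (h1.add h2).congr_fun (hterm s hs)
  refine ⟨fun s hs ↦ (hsum s hs).summable, ?_⟩
  obtain ⟨B, hB0, hB⟩ := exists_expansion_mlSum hr hξ hβ z₀ hρ'
  have hTs : Tendsto (fun s : ℝ ↦ T * s) atTop atTop := tendsto_id.const_mul_atTop hT
  have hR1 := (tendsto_const_mul u (hB.comp hTs)).const_smul ((T : ℂ) ^ L)⁻¹
  have hR2 := tendsto_finsetSum (Finset.range N) fun m _ ↦
    tendsto_exp_smul_seriesTerm r a hβ hT φ m L
  have hR := hR1.add hR2
  rw [mul_zero, smul_zero, Finset.sum_const_zero, add_zero] at hR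
  refine ⟨B, hB0, _, hR, ?_⟩
  filter_upwards [eventually_gt_atTop 0] with s hs
  rw [seriesSum, (hsum s hs).tsum_eq, ← Finset.smul_sum]
  have hs' : (s : ℂ) ≠ 0 := Complex.ofReal_ne_zero.2 hs.ne'
  have hT' : (T : ℂ) ≠ 0 := Complex.ofReal_ne_zero.2 hT.ne'
  simp only [Function.comp, Complex.ofReal_mul]
  generalize ∑ m ∈ Finset.range N, seriesTerm r a β φ s m = S
  generalize ∑ l ∈ Finset.range (L + 1), ((T * s : ℂ) ^ l)⁻¹ • B l = S'
  have he : (Real.exp (T * s) : ℂ) * (Real.exp (-(T * s)) : ℂ) = 1 := by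
    rw [← Complex.ofReal_mul, ← Real.exp_add]
    simp
  have e1 : ((s : ℂ) ^ L)⁻¹ * (((T : ℂ) ^ L)⁻¹ * (T * s : ℂ) ^ L) = 1 := by
    rw [mul_pow]
    field_simp
  have e2 : ((s : ℂ) ^ L)⁻¹ * ((s : ℂ) ^ L * (Real.exp (-(T * s)) : ℂ)) =
      (Real.exp (-(T * s)) : ℂ) := by
    field_simp
  simp only [mul_smul_comm, mul_sub]
  generalize u * S' = V
  rw [smul_add ((s : ℂ) ^ L)⁻¹, smul_smul ((s : ℂ) ^ L)⁻¹ ((T : ℂ) ^ L)⁻¹, smul_smul, mul_assoc, e1,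
    one_smul, smul_smul, e2, ← add_assoc, add_sub_cancel, ← smul_add, smul_smul, he, one_smul]

theorem exp_I_mul_pow_eq_one_iff {r : ℕ} (hr : 0 < r) (ψ : ℝ) :
    Complex.exp (Complex.I * ψ) ^ r = 1 ↔ ∃ k : ℤ, ψ = 2 * Real.pi / r * k := by
  have hr' : (r : ℝ) ≠ 0 := Nat.cast_ne_zero.2 hr.ne'
  rw [← Complex.exp_nat_mul, Complex.exp_eq_one_iff]
  refine exists_congr fun k ↦ ⟨fun h ↦ ?_, fun h ↦ ?_⟩
  · have := congrArg Complex.im h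
    simp at this
    field_simp
    linarith
  · rw [h]
    push_cast
    have : (r : ℂ) ≠ 0 := Nat.cast_ne_zero.2 hr.ne'
    field_simp

end SeriesAsymptotics

end

/-! ### Asymptotics of Mittag-Leffler type series on a ray -/

theorem mainTheorem1 {X : Type*} [TopologicalSpace X] [T2Space X] [SecondCountableTopology X]
    [ConnectedSpace X] {d : ℕ} [ChartedSpace (EuclideanSpace ℝ (Fin d)) X]
    [IsManifold (𝓡 d) ∞ X] [FiniteDimensional ℂ (Cohomology X)]
    (r : ℕ) (hr : 0 < r) (a : ℕ → Cohomology X) (β : Cohomology X)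
    (T : ℝ) (hT : 0 < T) (θ : ℝ) (A : Cohomology X)
    (ha : IsAsymptoticallyMittagLeffler r a β T θ A) (φ : ℝ) :
    -- the series converges on the ray
    (∀ s : ℝ, 0 < s → Summable (seriesTerm r a β φ s)) ∧
    -- leading order
    ((∃ k : ℤ, θ + φ = 2 * Real.pi / r * k) →
      ∃ R : ℝ → Cohomology X, Tendsto R atTop (𝓝 0) ∧
        ∀ᶠ s : ℝ in atTop, seriesSum r a β φ s =
          ((1 / r : ℂ) * Real.exp (T * s)) • (Cohomology.cis (θ + φ) β * (A + R s))) ∧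
    ((¬ ∃ k : ℤ, θ + φ = 2 * Real.pi / r * k) →
      ∃ R : ℝ → Cohomology X, Tendsto R atTop (𝓝 0) ∧
        ∀ᶠ s : ℝ in atTop, seriesSum r a β φ s = (Real.exp (T * s) : ℂ) • R s) ∧
    -- asymptotic series
    (∀ (L : ℕ) (A' : ℕ → Cohomology X), A' 0 = A → HasMittagLefflerExpansion r a β T θ L A' →
      ((∃ k : ℤ, θ + φ = 2 * Real.pi / r * k) →
        ∃ B : ℕ → Cohomology X, B 0 = A ∧
        ∃ R : ℝ → Cohomology X, Tendsto R atTop (𝓝 0) ∧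
          ∀ᶠ s : ℝ in atTop, seriesSum r a β φ s =
            (Real.exp (T * s) : ℂ) •
              (∑ l ∈ Finset.range (L + 1),
                  ((1 / r : ℂ) * ((T * s : ℂ) ^ l)⁻¹) • (Cohomology.cis (θ + φ) β * B l) +
                ((s : ℂ) ^ L)⁻¹ • R s)) ∧
      ((¬ ∃ k : ℤ, θ + φ = 2 * Real.pi / r * k) →
        ∃ R : ℝ → Cohomology X, Tendsto R atTop (𝓝 0) ∧
          ∀ᶠ s : ℝ in atTop, seriesSum r a β φ s =
            (Real.exp (T * s) : ℂ) • ((s : ℂ) ^ L)⁻¹ • R s)) := by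
  have : LocallyPathConnectedSpace X :=
    ChartedSpace.locallyPathConnectedSpace (EuclideanSpace ℝ (Fin d)) X
  have : PathConnectedSpace X := pathConnectedSpace_iff_connectedSpace.2 inferInstance
  have hβ : IsNilpotent (Cohomology.degPos β) := Cohomology.isNilpotent_degPos β
  have hr' : (r : ℂ) ≠ 0 := Nat.cast_ne_zero.2 hr.ne'
  have hδ := exp_I_mul_pow_eq_one_iff hr (θ + φ)
  obtain ⟨R, hR, haR⟩ := ha
  have hρ : HasInvExpansion 0 (fun m ↦ A + R m) A := by
    have := hR.const_add A
    rwa [add_zero] at this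
  obtain ⟨hs, B, hB, S, hS, hsum⟩ := exists_expansion_seriesSum hr a hβ hT θ φ hρ haR
  refine ⟨hs, fun hk ↦ ?_, fun hk ↦ ?_, fun L A' hA' hexp ↦ ?_⟩
  · -- the error term is moved inside the brackets by means of the inverse of `e^{i(θ+φ)β}`
    refine ⟨fun s ↦ (r : ℂ) • (Cohomology.cis (-(θ + φ)) β * S s), ?_, ?_⟩
    · simpa using (tendsto_const_mul (Cohomology.cis (-(θ + φ)) β) hS).const_smul (r : ℂ)
    · filter_upwards [hsum] with s h
      rw [h, mlDensity, if_pos (hδ.2 hk), mul_comm (1 / r : ℂ), mul_smul, mul_add,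
        mul_smul_comm (r : ℂ), ← mul_assoc, cis_mul_cis_neg _ hβ, one_mul, smul_add (1 / r : ℂ),
        smul_smul (1 / r : ℂ) (r : ℂ), one_div_mul_cancel hr', one_smul]
      simp [hB]
  · refine ⟨S, hS, ?_⟩
    filter_upwards [hsum] with s h
    rw [h, mlDensity, if_neg (mt hδ.1 hk)]
    simp
  · obtain ⟨R', hR', haR'⟩ := hexp
    let ρ : ℕ → Cohomology X := fun m ↦
      ∑ l ∈ Finset.range (L + 1), ((m : ℂ) ^ l)⁻¹ • A' l + ((m : ℂ) ^ L)⁻¹ • R' m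
    have hρ' : HasInvExpansion L ρ (A' 0) :=
      hasInvExpansion_of_eventuallyEq hR' (.of_forall fun m ↦ rfl)
    obtain ⟨-, B', hB', S', hS', hsum'⟩ := exists_expansion_seriesSum hr a hβ hT θ φ hρ' haR'
    refine ⟨fun hk ↦ ⟨B', hB'.trans hA', S', hS', ?_⟩, fun hk ↦ ⟨S', hS', ?_⟩⟩
    · filter_upwards [hsum'] with s h
      rw [h, mlDensity, if_pos (hδ.2 hk), mul_smul_comm, Finset.mul_sum, Finset.smul_sum]
      simp only [mul_smul_comm, smul_smul]
    · filter_upwards [hsum'] with s h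
      rw [h, mlDensity, if_neg (mt hδ.1 hk)]
      simp [smul_smul]
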